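/- Let $n\ge 1$, let $r\in\{\infty,\omega\}$ ($C^\omega$ means real analytic), and let $\mathbb R^{n+1}_1$ be $\mathbb R^{n+1}$ with the Lorentzian inner product $\langle v,w\rangle=-v_0w_0+\sum_{i=1}^n v_iw_i$. Manifolds are Hausdorff, second countable and without boundary; they need not be connected. **Definitions.** Let $M$ be a $C^r$ manifold. A *$C^r$ wave front* $F:M\to\mathbb R^k$ with projective Gauss map $\alpha$ is a $C^r$ map $F$ together with a $C^r$ map $\alpha:M\to P^*(\mathbb R^k)$ into the projective space of the dual space $(\mathbb R^k)^*$ such that $dF_p(T_pM)\subset\operatorname{Ker}(\alpha_p)$ for all $p\in M$ and such that $(F,\alpha):M\to\mathbb R^k\times P^*(\mathbb R^k)$ is an immersion. It is *co-orientable* if $\alpha=[\tilde\alpha]$ for some $C^r$ map $\tilde\alpha:M\to(\mathbb R^k)^*\setminus\{0\}$. A *unit normal vector field* of a wave front in the Euclidean space $\mathbb R^k_0$ is a $C^r$ map $\nu:M\to\mathbb R^k$ with $|\nu|=1$ and $\alpha=[(\nu,\cdot)]$. A co-orientable $C^r$ wave front $F:M^n\to\mathbb R^{n+1}_1$ on an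 $n$-manifold is *null* if it has a $C^r$ normal vector field $\hat\xi:M^n\to\mathbb R^{n+1}_1\setminus\{0\}$, $\alpha=[\langle\hat\xi,\cdot\rangle]$, with $\langle\hat\xi,\hat\xi\rangle=0$ everywhere. There is then exactly one such normal vector field $\hat\xi_E$ that is future-pointing ($(\hat\xi_E)_0>0$) and of Euclidean length $\sqrt2$, and exactly one $C^r$ vector field $\xi_E$ on $M^n$ with $dF(\xi_E)=\hat\xi_E$. The null wave front $F$ is *$L$-complete* if for each $p\in M^n$ there is an integral curve $\gamma:\mathbb R\to M^n$ of $\xi_E$ passing through $p$ such that $F(\gamma(\mathbb R))$ is an entire light-like line of $\mathbb R^{n+1}_1$. **Theorem (a fundamental theorem of $L$-complete null wave fronts).** Let $F:M^n\to\mathbb R^{n+1}_1$ be a co-orientable $L$-complete $C^r$ null wave front. Then there exist a $C^r$ manifold $\Sigma$ of dimension $n-1$, a $C^r$ diffeomorphism $\Phi:\mathbb R\times\Sigma\to M^n$, and a co-orientable $C^r$ wave front $f:\Sigma\to\mathbb R^n_0$ with a unit normal vector field $\nu$, such that $F\circ\Phi$ is the normal form $$\mathcal F^f_+(t,p)=(0,f(p))+t\,(1,\nu(p))\qquad(t\in\mathbb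 R,\ p\in\Sigma).$$ -/

import Mathlib

universe u

open scoped Manifold ContDiff LinearAlgebra.Projectivization

noncomputable section

/-- `E k` is the coordinate space `ℝ^k` with its Euclidean inner product and norm. -/
abbrev E (k : ℕ) : Type := EuclideanSpace ℝ (Fin k)

/-- The projective space `P^*(ℝ^k)` of the dual space `(ℝ^k)^*`. -/
abbrev PDual (k : ℕ) : Type := ℙ ℝ (StrongDual ℝ (E k))

/-- The standard affine chart of `P^*(ℝ^k)` determined by a vector `e`. Its domain is
`{[φ] | φ e ≠ 0}`, its image is the affine hyperplane `{φ | φ e = 1}` of the dual space, and it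
sends `[φ]` to `φ / φ(e)`. Together these charts form the usual analytic atlas of `P^*(ℝ^k)`.
(The value `0` outside the domain is never used.) -/
def affineChart {k : ℕ} (e : E k) (ζ : PDual k) : StrongDual ℝ (E k) :=
  (ζ.rep e)⁻¹ • ζ.rep

/-- The chart does not depend on the representative. -/
theorem affineChart_mk {k : ℕ} (e : E k) (φ : StrongDual ℝ (E k)) (hφ : φ ≠ 0) :
    affineChart e (Projectivization.mk ℝ φ hφ) = (φ e)⁻¹ • φ := by
  obtain ⟨a, ha⟩ := Projectivization.exists_smul_eq_mk_rep ℝ φ hφ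
  have ha0 : (a : ℝ) ≠ 0 := a.ne_zero
  have h : (Projectivization.mk ℝ φ hφ).rep = (a : ℝ) • φ := ha.symm
  unfold affineChart
  rw [h, smul_smul]
  congr 1
  change ((a : ℝ) * φ e)⁻¹ * (a : ℝ) = (φ e)⁻¹
  rw [mul_inv, mul_comm, ← mul_assoc, mul_inv_cancel₀ ha0, one_mul]

section Fronts

variable (n : ℕ) {k : ℕ} {M : Type*} [TopologicalSpace M] [ChartedSpace (E n) M]

/-- `α : M → P^*(ℝ^k)` is a `C^r` map: it is `C^r` at each point in the affine charts. -/
def IsProjSmooth (r : ℕ∞ω) (α : M → PDual k) : Prop :=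
  ∀ (p : M) (e : E k), (α p).rep e ≠ 0 →
    ContMDiffAt (𝓡 n) 𝓘(ℝ, StrongDual ℝ (E k)) r (fun q => affineChart e (α q)) p

/-- `F : M → ℝ^k` is a `C^r` frontal with projective Gauss map `α : M → P^*(ℝ^k)`:
both maps are `C^r` and `dF_p(v) ∈ Ker(α_p)`. -/
def IsFrontal (r : ℕ∞ω) (F : M → E k) (α : M → PDual k) : Prop :=
  ContMDiff (𝓡 n) (𝓡 k) r F ∧ IsProjSmooth n r α ∧
    ∀ (p : M) (v : TangentSpace (𝓡 n) p), (α p).rep (mfderiv (𝓡 n) (𝓡 k) F p v : E k) = 0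

/-- `φ : M → (ℝ^k)^* ∖ {0}` is a `C^r` lift of `α : M → P^*(ℝ^k)`. -/
def IsLift (r : ℕ∞ω) (α : M → PDual k) (φ : M → StrongDual ℝ (E k)) : Prop :=
  ContMDiff (𝓡 n) 𝓘(ℝ, StrongDual ℝ (E k)) r φ ∧
    ∀ p, ∃ h : φ p ≠ 0, α p = Projectivization.mk ℝ (φ p) h

/-- A frontal with projective Gauss map `α` is co-orientable if `α` has a `C^r` lift. -/
def IsCoorientable (r : ℕ∞ω) (α : M → PDual k) : Prop :=
  ∃ φ : M → StrongDual ℝ (E k), IsLift n r α φ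

/-- `F` is a `C^r` wave front with projective Gauss map `α`: a `C^r` frontal for which
`(F, α) : M → ℝ^k × P^*(ℝ^k)` is an immersion, i.e. has injective differential at every point;
the differential is computed in the affine charts of `P^*(ℝ^k)`. -/
def IsFront (r : ℕ∞ω) (F : M → E k) (α : M → PDual k) : Prop :=
  IsFrontal n r F α ∧
    ∀ (p : M) (e : E k), (α p).rep e ≠ 0 →
      Function.Injective
        (mfderiv (𝓡 n) 𝓘(ℝ, E k × StrongDual ℝ (E k)) (fun q => (F q, affineChart e (α q))) p)

/-- `F` is a co-orientable `C^r` wave front with projective Gauss map `α`. -/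
def IsCoorientableFront (r : ℕ∞ω) (F : M → E k) (α : M → PDual k) : Prop :=
  IsFront n r F α ∧ IsCoorientable n r α

/-- `ν` is a `C^r` unit normal vector field of the frontal with projective Gauss map `α`
in Euclidean space: `|ν| = 1` and `(ν, ·)` is a lift of `α`. -/
def IsUnitNormal (r : ℕ∞ω) (α : M → PDual k) (ν : M → E k) : Prop :=
  ContMDiff (𝓡 n) (𝓡 k) r ν ∧ (∀ p, ‖ν p‖ = 1) ∧ IsLift n r α (fun p => innerSL ℝ (ν p))

end Fronts

/-- The Lorentzian inner product of signature `(-+⋯+)` on `ℝ^{n+1}_1`; the coordinate `0`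
is the time coordinate. -/
def lorentz {n : ℕ} (v w : E (n + 1)) : ℝ :=
  -(v 0 * w 0) + ∑ i : Fin n, v i.succ * w i.succ

/-- A light-like line of `ℝ^{n+1}_1`, as an entire affine line. -/
def IsLightlikeLine {n : ℕ} (S : Set (E (n + 1))) : Prop :=
  ∃ a w : E (n + 1), w ≠ 0 ∧ lorentz w w = 0 ∧ S = Set.range (fun t : ℝ => a + t • w)

/-- The vector `(t, x)` of `ℝ^{n+1}_1` with time coordinate `t` and space part `x`. -/
def spacetime {n : ℕ} (t : ℝ) (x : E n) : E (n + 1) :=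
  WithLp.toLp 2 (Fin.cons t (fun i => x i))

/-- The normal form `𝓕^f_+(t, p) = (0, f(p)) + t (1, ν(p))`. -/
def normalForm {n : ℕ} {S : Type*} (f ν : S → E n) (x : ℝ × S) : E (n + 1) :=
  spacetime 0 (f x.2) + x.1 • spacetime 1 (ν x.2)

section Null

variable (n : ℕ) {m : ℕ} {M : Type*} [TopologicalSpace M] [ChartedSpace (E n) M]

/-- `ξ` is a `C^r` normal vector field along the frontal with projective Gauss map `α`:
`⟨ξ_p, ·⟩ = φ_p` for a lift `φ` of `α`. In particular `ξ` has no zeros, and it is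
Lorentz-orthogonal to the image of the differential of the frontal. -/
def IsNormalField (r : ℕ∞ω) (α : M → PDual (m + 1)) (ξ : M → E (m + 1)) : Prop :=
  ContMDiff (𝓡 n) (𝓡 (m + 1)) r ξ ∧
    ∃ φ : M → StrongDual ℝ (E (m + 1)), IsLift n r α φ ∧ ∀ p x, lorentz (ξ p) x = φ p x

/-- `F : M → ℝ^{m+1}_1` is a co-orientable `C^r` null wave front: a co-orientable wave front with
a normal vector field that is light-like at every point. -/
def IsNullFront (r : ℕ∞ω) (F : M → E (m + 1)) (α : M → PDual (m + 1)) : Prop :=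
  IsCoorientableFront n r F α ∧
    ∃ ξ : M → E (m + 1), IsNormalField n r α ξ ∧ ∀ p, lorentz (ξ p) (ξ p) = 0

/-- The normal vector field `ξ` is `E`-normalized: future-pointing, of Euclidean length `√2`. -/
def IsENormalized (r : ℕ∞ω) (α : M → PDual (m + 1)) (ξ : M → E (m + 1)) : Prop :=
  IsNormalField n r α ξ ∧ ∀ p, 0 < ξ p 0 ∧ ‖ξ p‖ = √2

/-- `X` is a `C^r` vector field on `M`, i.e. a `C^r` section of the tangent bundle. -/
def IsSmoothVectorField [IsManifold (𝓡 n) 1 M] (r : ℕ∞ω)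
    (X : (p : M) → TangentSpace (𝓡 n) p) : Prop :=
  ContMDiff (𝓡 n) (𝓡 n).tangent r (fun p => (⟨p, X p⟩ : TangentBundle (𝓡 n) M))

/-- `X` is the `E`-normalized null vector field of the null wave front `F`: a `C^r` vector field
on `M` such that `dF(X)` is the `E`-normalized normal vector field along `F`. -/
def IsENullField [IsManifold (𝓡 n) 1 M] (r : ℕ∞ω) (F : M → E (m + 1)) (α : M → PDual (m + 1))
    (X : (p : M) → TangentSpace (𝓡 n) p) : Prop :=
  IsSmoothVectorField n r X ∧
    ∃ ξ : M → E (m + 1), IsENormalized n r α ξ ∧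
      ∀ p, (mfderiv (𝓡 n) (𝓡 (m + 1)) F p (X p) : E (m + 1)) = ξ p

/-- The null wave front `F` is `L`-complete: through each point `p` of `M` passes an integral curve
`γ : ℝ → M` of the `E`-normalized null vector field such that `F ∘ γ (ℝ)` is an entire light-like
line. The null vector field of a null wave front exists and is unique; the universal quantifier
over `X` is used so that `L`-completeness does not contain the existence of `X` as an assumption. -/
def IsLComplete [IsManifold (𝓡 n) 1 M] (r : ℕ∞ω) (F : M → E (m + 1)) (α : M → PDual (m + 1)) :
    Prop :=
  ∀ X : (p : M) → TangentSpace (𝓡 n) p, IsENullField n r F α X →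
    ∀ p : M, ∃ γ : ℝ → M, IsMIntegralCurve (I := 𝓡 n) γ X ∧ p ∈ Set.range γ ∧
      IsLightlikeLine (Set.range (F ∘ γ))

end Null

/-- A `C^r` manifold, with `r = ∞` or `r = ω`, is a `C^1` manifold. -/
theorem isManifold_one (n : ℕ) {r : ℕ∞ω} (hr : r = ∞ ∨ r = ω) (M : Type*) [TopologicalSpace M]
    [ChartedSpace (E n) M] [IsManifold (𝓡 n) r M] : IsManifold (𝓡 n) 1 M := by
  refine IsManifold.of_le (n := r) ?_
  rcases hr with rfl | rfl
  · exact_mod_cast le_top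
  · exact le_top

end

/-! Scale the null normal field so that `ξ = (1, ν)` with `|ν| = 1`. The front condition says that
the pair `(F, ξ)` is an immersion of `M` into a vector space. The Legendrian relation `⟨ξ, dF⟩ = 0`,
once differentiated, says that `⟨dξ, dF⟩` is symmetric. Modulo multiples of `ξ`, the pair `(dF, dξ)`
thus maps the `n`-dimensional tangent space onto an isotropic subspace of `ν^⊥ × ν^⊥`. Since `ν^⊥`
has dimension `n - 1`, the map has a kernel, and injectivity of `d(F, ξ)` turns a kernel vector into
a vector `X` with `dF(X) = ξ` and `dξ(X) = 0`, even at singular points of `F`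
(`exists_null_direction`, `exists_tangent_null`). Along an integral curve of `X` the direction `ξ`
is constant and `F` moves on a light-like line.

`L`-completeness supplies entire integral curves. Together they lift the explicit flow `(x, w) ↦ (x
+ t w, w)` through the immersion `(F, ξ)`. Continuous lifts of curves through an immersion of a
Hausdorff manifold are unique, so the lifted curves form a one-parameter group that is jointly
continuous and then `C^r` (`IsFlowLift.add`, `IsFlowLift.continuous`, `IsFlowLift.contMDiff`);
smooth dependence of solutions of differential equations is not needed.

The time coordinate `τ` of `F` grows at unit speed along this flow. Hence `Σ = {τ = 0}` is a regular
level set meeting every orbit exactly once, and flowing from `Σ` gives the diffeomorphism `ℝ × Σ →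
M`. The space parts of `F` and `ξ` on `Σ` are `f` and `ν`; their time parts are constant there, so
the immersion property of `(F, ξ)` passes to `(f, ν)`. -/

noncomputable section

open Set Filter Topology

/-! ### Inverse function theorem and immersions on manifolds -/

section LocalDiffeomorphisms

variable {H H' V : Type*} [NormedAddCommGroup H] [NormedSpace ℝ H]
  [NormedAddCommGroup H'] [NormedSpace ℝ H'] [NormedAddCommGroup V] [NormedSpace ℝ V]
  {M : Type*} [TopologicalSpace M] [ChartedSpace H M] {r : ℕ∞ω}

/-- The inverse function theorem in a Banach space, as a statement about local diffeomorphisms. -/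
theorem ContDiffOn.isLocalDiffeomorphAt [CompleteSpace H] {h : H → H'} {U : Set H}
    (hU : IsOpen U) (hh : ContDiffOn ℝ r h U) (hr : r ≠ 0) {x : H} (hx : x ∈ U)
    (hd : ∃ A : H ≃L[ℝ] H', (A : H →L[ℝ] H') = fderiv ℝ h x) :
    IsLocalDiffeomorphAt 𝓘(ℝ, H) 𝓘(ℝ, H') r h x := by
  obtain ⟨A, hA⟩ := hd
  have hat : ∀ y ∈ U, ContDiffAt ℝ r h y := fun y hy => hh.contDiffAt (hU.mem_nhds hy)
  have hder : ∀ y ∈ U, HasFDerivAt h (fderiv ℝ h y) y := fun y hy =>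
    ((hat y hy).differentiableAt hr).hasFDerivAt
  have hA' : HasFDerivAt h (A : H →L[ℝ] H') x := hA ▸ hder x hx
  have hcont : ContinuousOn (fderiv ℝ h) U :=
    (hh.of_le (ENat.one_le_iff_ne_zero_withTop.2 hr)).continuousOn_fderiv_of_isOpen hU le_rfl
  -- On `W` the derivative is invertible at every point, so the inverse is `C^r` on the whole target
  -- after restriction, not only at `h x`.
  set W : Set H := U ∩ fderiv ℝ h ⁻¹' range ((↑) : (H ≃L[ℝ] H') → H →L[ℝ] H')
  have hWo : IsOpen W := hcont.isOpen_inter_preimage hU ContinuousLinearEquiv.isOpen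
  set e := (hat x hx).toOpenPartialHomeomorph h hA' hr
  have hxe : x ∈ e.source := (hat x hx).mem_toOpenPartialHomeomorph_source hA' hr
  let e' := e.restrOpen W hWo
  have hsrc : e'.source = e.source ∩ W := e.restrOpen_source W hWo
  have he'h : (e' : H → H') = h := rfl
  refine ⟨⟨e'.toPartialEquiv, e'.open_source, e'.open_target, ?_, ?_⟩, ?_, fun y _ => rfl⟩
  · exact (hh.mono fun y hy => (hsrc ▸ hy : y ∈ e.source ∩ W).2.1).contMDiffOn
  · intro y hy
    have hy' : e'.symm y ∈ e.source ∩ W := hsrc ▸ e'.map_target hy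
    obtain ⟨B, hB⟩ := hy'.2.2
    refine (ContMDiffAt.contMDiffWithinAt ?_)
    refine (e'.contDiffAt_symm (f₀' := B) hy ?_ ?_).contMDiffAt
    · rw [he'h, hB]; exact hder _ hy'.2.1
    · exact hat _ hy'.2.1
  · exact (hsrc ▸ ⟨hxe, hx, A, hA⟩ : x ∈ e'.source)

/-- The preferred charts of a manifold are local diffeomorphisms. -/
theorem isLocalDiffeomorphAt_chartAt [IsManifold 𝓘(ℝ, H) r M] (p : M) :
    IsLocalDiffeomorphAt 𝓘(ℝ, H) 𝓘(ℝ, H) r (chartAt H p) p :=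
  ⟨⟨(chartAt H p).toPartialEquiv, (chartAt H p).open_source, (chartAt H p).open_target,
    contMDiffOn_chart, contMDiffOn_chart_symm⟩, mem_chart_source H p, fun _ _ => rfl⟩

theorem IsLocalDiffeomorphAt.congr_of_eventuallyEq {E₁ E₂ H₁ H₂ M₁ M₂ : Type*}
    [NormedAddCommGroup E₁] [NormedSpace ℝ E₁] [NormedAddCommGroup E₂] [NormedSpace ℝ E₂]
    [TopologicalSpace H₁] [TopologicalSpace H₂] {I : ModelWithCorners ℝ E₁ H₁}
    {J : ModelWithCorners ℝ E₂ H₂} [TopologicalSpace M₁] [ChartedSpace H₁ M₁]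
    [TopologicalSpace M₂] [ChartedSpace H₂ M₂] {f g : M₁ → M₂} {p : M₁}
    (hf : IsLocalDiffeomorphAt I J r f p) (hfg : g =ᶠ[𝓝 p] f) :
    IsLocalDiffeomorphAt I J r g p := by
  obtain ⟨e, hp, he⟩ := hf
  obtain ⟨W, hW, hWo, hpW⟩ := eventually_nhds_iff.1 hfg
  let e' := e.toOpenPartialHomeomorph.restrOpen W hWo
  have hsrc : e'.source = e.source ∩ W := e.toOpenPartialHomeomorph.restrOpen_source W hWo
  have htgt : e'.target ⊆ e.target := inter_subset_left
  refine ⟨⟨e'.toPartialEquiv, e'.open_source, e'.open_target,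
    e.contMDiffOn_toFun.mono fun y hy => (hsrc ▸ hy : y ∈ e.source ∩ W).1,
    e.contMDiffOn_invFun.mono htgt⟩, (hsrc ▸ ⟨hp, hpW⟩ : p ∈ e'.source), fun y hy => ?_⟩
  have hy' : y ∈ e.source ∩ W := hsrc ▸ hy
  exact (hW y hy'.2).trans (he hy'.1)

/-- The derivative of a map from a manifold to a normed space, in the preferred chart. -/
theorem HasMFDerivAt.hasFDerivAt_chart {h : M → H'} {p : M} {h' : H →L[ℝ] H'}
    (hh : HasMFDerivAt 𝓘(ℝ, H) 𝓘(ℝ, H') h p h') :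
    HasFDerivAt (h ∘ (chartAt H p).symm) h' (chartAt H p p) := by
  have h2 := hh.2
  simp only [writtenInExtChartAt, extChartAt, OpenPartialHomeomorph.extend, mfld_simps] at h2
  exact hasFDerivWithinAt_univ.1 h2

/-- The inverse function theorem for maps from a manifold to a normed space. -/
theorem ContMDiffAt.isLocalDiffeomorphAt [CompleteSpace H] [IsManifold 𝓘(ℝ, H) r M]
    {h : M → H'} {p : M} {U : Set M} (hU : U ∈ 𝓝 p)
    (hh : ContMDiffOn 𝓘(ℝ, H) 𝓘(ℝ, H') r h U) (hr : r ≠ 0)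
    (hd : ∃ A : H ≃L[ℝ] H', (A : H →L[ℝ] H') = mfderiv 𝓘(ℝ, H) 𝓘(ℝ, H') h p) :
    IsLocalDiffeomorphAt 𝓘(ℝ, H) 𝓘(ℝ, H') r h p := by
  set φ := chartAt H p
  have hp : p ∈ φ.source := mem_chart_source H p
  obtain ⟨W, hWU, hWo, hpW⟩ := mem_nhds_iff.1 hU
  have hopen : IsOpen (φ.target ∩ φ.symm ⁻¹' W) :=
    φ.continuousOn_symm.isOpen_inter_preimage φ.open_target hWo
  have hsm : ContDiffOn ℝ r (h ∘ φ.symm) (φ.target ∩ φ.symm ⁻¹' W) := by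
    rw [← contMDiffOn_iff_contDiffOn]
    exact (hh.mono hWU).comp (contMDiffOn_chart_symm.mono inter_subset_left)
      inter_subset_right
  have hmd : MDifferentiableAt 𝓘(ℝ, H) 𝓘(ℝ, H') h p :=
    (hh.contMDiffAt hU).mdifferentiableAt hr
  have hfd : (mfderiv 𝓘(ℝ, H) 𝓘(ℝ, H') h p : H →L[ℝ] H') = fderiv ℝ (h ∘ φ.symm) (φ p) :=
    hmd.hasMFDerivAt.hasFDerivAt_chart.fderiv.symm
  have hmem : φ p ∈ φ.target ∩ φ.symm ⁻¹' W :=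
    ⟨φ.map_source hp, by simpa [φ.left_inv hp] using hpW⟩
  have hd' : ∃ A : H ≃L[ℝ] H', (A : H →L[ℝ] H') = fderiv ℝ (h ∘ φ.symm) (φ p) := by
    obtain ⟨A, hA⟩ := hd
    exact ⟨A, hA.trans hfd⟩
  have key := (isLocalDiffeomorphAt_chartAt (r := r) p).comp _ _
    (ContDiffOn.isLocalDiffeomorphAt hopen hsm hr hmem hd')
  refine key.congr_of_eventuallyEq ?_
  filter_upwards [φ.open_source.mem_nhds hp] with y hy
  simp only [Function.comp_apply]
  rw [φ.left_inv hy]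

/-- An immersion into a finite-dimensional space becomes a local diffeomorphism after
composition with a suitable linear map. -/
theorem exists_isLocalDiffeomorphAt_of_injective_mfderiv [FiniteDimensional ℝ V]
    [FiniteDimensional ℝ H] [IsManifold 𝓘(ℝ, H) r M] {G : M → V}
    (hG : ContMDiff 𝓘(ℝ, H) 𝓘(ℝ, V) r G) (hr : r ≠ 0) (p : M)
    (hinj : Function.Injective (mfderiv 𝓘(ℝ, H) 𝓘(ℝ, V) G p)) :
    ∃ ℓ : V →L[ℝ] H, IsLocalDiffeomorphAt 𝓘(ℝ, H) 𝓘(ℝ, H) r (ℓ ∘ G) p := by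
  have : CompleteSpace H := FiniteDimensional.complete ℝ H
  let D : H →L[ℝ] V := mfderiv 𝓘(ℝ, H) 𝓘(ℝ, V) G p
  -- A linear left inverse `ℓ` of the differential makes the derivative of `ℓ ∘ G` at `p` the
  -- identity.
  obtain ⟨ℓ, hℓ⟩ := LinearMap.exists_leftInverse_of_injective (D : H →ₗ[ℝ] V)
    (LinearMap.ker_eq_bot.2 hinj)
  refine ⟨LinearMap.toContinuousLinearMap ℓ, ?_⟩
  have hsm : ContMDiff 𝓘(ℝ, H) 𝓘(ℝ, H) r (LinearMap.toContinuousLinearMap ℓ ∘ G) :=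
    (LinearMap.toContinuousLinearMap ℓ).contMDiff.comp hG
  refine ContMDiffAt.isLocalDiffeomorphAt univ_mem hsm.contMDiffOn hr
    ⟨ContinuousLinearEquiv.refl ℝ H, ?_⟩
  have hc : mfderiv 𝓘(ℝ, H) 𝓘(ℝ, H) (LinearMap.toContinuousLinearMap ℓ ∘ G) p
      = (LinearMap.toContinuousLinearMap ℓ).comp D := by
    rw [mfderiv_comp p ((LinearMap.toContinuousLinearMap ℓ).mdifferentiableAt)
      (hG.mdifferentiable hr p)]
    rw [ContinuousLinearMap.mfderiv_eq]
    rfl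
  rw [hc]
  ext v
  exact (LinearMap.congr_fun hℓ v).symm

/-- A continuous lift of a `C^r` map through a `C^r` immersion is `C^r`. -/
theorem ContinuousAt.contMDiffAt_of_comp_immersion [FiniteDimensional ℝ V]
    [FiniteDimensional ℝ H] [IsManifold 𝓘(ℝ, H) r M] {G : M → V}
    (hG : ContMDiff 𝓘(ℝ, H) 𝓘(ℝ, V) r G) (hr : r ≠ 0)
    {E₁ H₁ N : Type*} [NormedAddCommGroup E₁] [NormedSpace ℝ E₁] [TopologicalSpace H₁]
    {I : ModelWithCorners ℝ E₁ H₁} [TopologicalSpace N] [ChartedSpace H₁ N] {f : N → M} {x : N}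
    (hf : ContinuousAt f x)
    (hinj : Function.Injective (mfderiv 𝓘(ℝ, H) 𝓘(ℝ, V) G (f x)))
    (hGf : ContMDiffAt I 𝓘(ℝ, V) r (G ∘ f) x) : ContMDiffAt I 𝓘(ℝ, H) r f x := by
  obtain ⟨ℓ, hℓ⟩ := exists_isLocalDiffeomorphAt_of_injective_mfderiv hG hr (f x) hinj
  have h1 : ContMDiffAt I 𝓘(ℝ, H) r (hℓ.localInverse ∘ (ℓ ∘ (G ∘ f))) x :=
    ContMDiffAt.comp x hℓ.localInverse_contMDiffAt (ℓ.contMDiff.contMDiffAt.comp x hGf)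
  refine h1.congr_of_eventuallyEq ?_
  -- Continuity of `f` keeps `f y` where the local inverse undoes `ℓ ∘ G`.
  filter_upwards [hf hℓ.localInverse_eventuallyEq_left] with y hy
  exact hy.symm

/-- An immersion is locally injective. -/
theorem isLocallyInjective_of_injective_mfderiv [FiniteDimensional ℝ V]
    [FiniteDimensional ℝ H] [IsManifold 𝓘(ℝ, H) r M] {G : M → V}
    (hG : ContMDiff 𝓘(ℝ, H) 𝓘(ℝ, V) r G) (hr : r ≠ 0)
    (hinj : ∀ p, Function.Injective (mfderiv 𝓘(ℝ, H) 𝓘(ℝ, V) G p)) : IsLocallyInjective G := by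
  intro p
  obtain ⟨ℓ, e, hp, he⟩ := exists_isLocalDiffeomorphAt_of_injective_mfderiv hG hr p (hinj p)
  refine ⟨e.source, e.open_source, hp, fun x hx y hy hxy => ?_⟩
  refine e.injOn hx hy ?_
  rw [← he hx, ← he hy, Function.comp_apply, Function.comp_apply, hxy]

end LocalDiffeomorphisms

/-! ### Lifting a flow through an immersion -/

section FlowLifting

variable {H V : Type*} [NormedAddCommGroup H] [NormedSpace ℝ H]
  [NormedAddCommGroup V] [NormedSpace ℝ V] [FiniteDimensional ℝ V] [FiniteDimensional ℝ H]
  {M : Type*} [TopologicalSpace M] [T2Space M] [ChartedSpace H M] {r : ℕ∞ω}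
  [IsManifold 𝓘(ℝ, H) r M]

/-- `φ` lifts the one-parameter family of maps `T` of a vector space through the map `G`. -/
structure IsFlowLift (G : M → V) (T : ℝ × V → V) (φ : ℝ → M → M) : Prop where
  zero : ∀ p, φ 0 p = p
  continuous_curve : ∀ p, Continuous fun t => φ t p
  lift : ∀ t p, G (φ t p) = T (t, G p)

namespace IsFlowLift

variable {G : M → V} {T : ℝ × V → V} {φ : ℝ → M → M}

/-- A lift of a flow through an immersion is a flow. -/
theorem add (hφ : IsFlowLift G T φ) (hG : ContMDiff 𝓘(ℝ, H) 𝓘(ℝ, V) r G) (hr : r ≠ 0)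
    (hinj : ∀ p, Function.Injective (mfderiv 𝓘(ℝ, H) 𝓘(ℝ, V) G p))
    (hT : ∀ s t v, T (s + t, v) = T (s, T (t, v))) (s t : ℝ) (p : M) :
    φ (s + t) p = φ s (φ t p) := by
  -- Both sides, as curves in `s`, are continuous lifts of the same curve and agree at `s = 0`.
  -- Lifts through a locally injective map from a Hausdorff space are unique over the connected
  -- line.
  have h := (T2Space.isSeparatedMap G).eq_of_comp_eq
    (isLocallyInjective_of_injective_mfderiv hG hr hinj)
    (g₁ := fun s => φ (s + t) p) (g₂ := fun s => φ s (φ t p))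
    ((hφ.continuous_curve p).comp (continuous_id.add continuous_const))
    (hφ.continuous_curve _) (by ext s; simp [hφ.lift, hT]) 0 (by simp [hφ.zero])
  exact congr_fun h s

/-- A lift of a flow through an immersion is continuous near time `0`. -/
theorem continuousAt_local (hφ : IsFlowLift G T φ) (hG : ContMDiff 𝓘(ℝ, H) 𝓘(ℝ, V) r G)
    (hr : r ≠ 0) (hinj : ∀ p, Function.Injective (mfderiv 𝓘(ℝ, H) 𝓘(ℝ, V) G p))
    (hTc : Continuous T) (hT0 : ∀ v, T (0, v) = v) (q : M) :
    ∃ ε > 0, ∃ U ∈ 𝓝 q, ∀ t ∈ Ioo (-ε) ε, ∀ p ∈ U, ContinuousAt (Function.uncurry φ) (t, p) := by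
  obtain ⟨ℓ, e, hq, he⟩ := exists_isLocalDiffeomorphAt_of_injective_mfderiv hG hr q (hinj q)
  let e' := e.toOpenPartialHomeomorph
  -- In the coordinates `ℓ ∘ G` the lifted flow must be `m`, which is visibly continuous in both
  -- variables.
  let m : ℝ × M → H := fun x => ℓ (T (x.1, G x.2))
  have hm : Continuous m := ℓ.continuous.comp
    (hTc.comp (continuous_fst.prodMk (hG.continuous.comp continuous_snd)))
  have hm0 : m (0, q) ∈ e'.target := by
    have : m (0, q) = e' q := by simp only [m, hT0]; exact he hq
    rw [this]; exact e'.map_source hq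
  have hnhds : m ⁻¹' e'.target ∩ univ ×ˢ e'.source ∈ 𝓝 ((0 : ℝ), q) :=
    inter_mem (hm.continuousAt.preimage_mem_nhds (e'.open_target.mem_nhds hm0))
      (prod_mem_nhds univ_mem (e'.open_source.mem_nhds hq))
  rw [nhds_prod_eq, mem_prod_iff] at hnhds
  obtain ⟨J, hJ, U, hU, hJU⟩ := hnhds
  obtain ⟨ε, hε, hεJ⟩ := Metric.mem_nhds_iff.1 hJ
  rw [Real.ball_eq_Ioo, zero_sub, zero_add] at hεJ
  obtain ⟨U', hU'U, hU'o, hqU'⟩ := mem_nhds_iff.1 hU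
  have hbox : ∀ t ∈ Ioo (-ε) ε, ∀ p ∈ U', m (t, p) ∈ e'.target ∧ p ∈ e'.source :=
    fun t ht p hp =>
      have := hJU (mk_mem_prod (hεJ ht) (hU'U hp))
      ⟨this.1, this.2.2⟩
  have hmφ : ∀ t p, φ t p ∈ e'.source → φ t p = e'.symm (m (t, p)) := fun t p h => by
    have : e' (φ t p) = m (t, p) := by
      rw [show m (t, p) = ℓ (G (φ t p)) by simp only [m, hφ.lift]]
      exact (he h).symm
    rw [← this, e'.left_inv h]
  have heq : ∀ t ∈ Ioo (-ε) ε, ∀ p ∈ U', φ t p = e'.symm (m (t, p)) := by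
    intro t ht p hp
    have hsub : PreconnectedSpace (Ioo (-ε) ε) :=
      isPreconnected_iff_preconnectedSpace.1 isPreconnected_Ioo
    have hc1 : Continuous fun t : Ioo (-ε) ε => φ t p :=
      (hφ.continuous_curve p).comp continuous_subtype_val
    have hc2 : Continuous fun t : Ioo (-ε) ε => e'.symm (m (t, p)) :=
      e'.continuousOn_symm.comp_continuous
        (hm.comp (continuous_subtype_val.prodMk continuous_const)) fun t => (hbox t t.2 p hp).1
    -- The agreement set is closed because `M` is Hausdorff. It is also the set of times at which
    -- the curve lies in the chart domain, hence open; connectedness of the interval finishes.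
    have hset : {t : Ioo (-ε) ε | φ t p = e'.symm (m (t, p))} =
        (fun t : Ioo (-ε) ε => φ t p) ⁻¹' e'.source := by
      ext t
      refine ⟨fun h => ?_, fun h => hmφ t p h⟩
      rw [mem_preimage, show φ t p = _ from h]
      exact e'.map_target (hbox t t.2 p hp).1
    have hclopen : IsClopen {t : Ioo (-ε) ε | φ t p = e'.symm (m (t, p))} :=
      ⟨isClosed_eq hc1 hc2, hset ▸ e'.open_source.preimage hc1⟩
    have huniv := hclopen.eq_univ ⟨⟨0, by simpa using hε⟩, by
      rw [hset, mem_preimage, hφ.zero]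
      exact (hbox 0 (by simpa using hε) p hp).2⟩
    exact (huniv ▸ mem_univ (⟨t, ht⟩ : Ioo (-ε) ε) :
      (⟨t, ht⟩ : Ioo (-ε) ε) ∈ {t : Ioo (-ε) ε | φ t p = e'.symm (m (t, p))})
  refine ⟨ε, hε, U', hU'o.mem_nhds hqU', fun t ht p hp => ?_⟩
  have hc : ContinuousAt (e'.symm ∘ m) (t, p) :=
    ContinuousAt.comp (e'.continuousOn_symm.continuousAt
      (e'.open_target.mem_nhds (hbox t ht p hp).1)) hm.continuousAt
  refine hc.congr ?_
  filter_upwards [prod_mem_nhds (isOpen_Ioo.mem_nhds ht) (hU'o.mem_nhds hp)] with x hx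
  exact (heq x.1 hx.1 x.2 hx.2).symm

/-- A lift of a flow through an immersion is jointly continuous. -/
theorem continuous (hφ : IsFlowLift G T φ) (hG : ContMDiff 𝓘(ℝ, H) 𝓘(ℝ, V) r G)
    (hr : r ≠ 0) (hinj : ∀ p, Function.Injective (mfderiv 𝓘(ℝ, H) 𝓘(ℝ, V) G p))
    (hTc : Continuous T) (hT0 : ∀ v, T (0, v) = v)
    (hT : ∀ s t v, T (s + t, v) = T (s, T (t, v))) : Continuous (Function.uncurry φ) := by
  rw [continuous_iff_continuousAt]
  rintro ⟨t, p⟩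
  have hlocal := hφ.continuousAt_local hG hr hinj hTc hT0
  -- Continuity at `(s, p)` is transported along the orbit of `p`: it is a locally constant property
  -- of `s`, and it holds at `s = 0`.
  let P : ℝ → ℝ → Prop := fun s t =>
    ContinuousAt (Function.uncurry φ) (s, p) ↔ ContinuousAt (Function.uncurry φ) (t, p)
  have hstep : ∀ t₁, ∀ᶠ s in 𝓝 t₁, P t₁ s := by
    intro t₁
    obtain ⟨ε, hε, U, hU, hc⟩ := hlocal (φ t₁ p)
    -- Factor `φ t = φ (t - s) ∘ φ s`: the outer map is continuous by the local statement at short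
    -- times, the inner one by assumption.
    have hmove : ∀ s t, φ s p ∈ U → |t - s| < ε →
        ContinuousAt (Function.uncurry φ) (s, p) → ContinuousAt (Function.uncurry φ) (t, p) := by
      intro s t hs hts hcs
      have h1 : ContinuousAt (Function.uncurry φ) (t - s, φ s p) := hc _ (abs_lt.1 hts) _ hs
      have h2 : ContinuousAt (fun x : ℝ × M => (x.1 - s, φ s x.2)) (t, p) := by
        refine ContinuousAt.prodMk (by fun_prop) ?_
        have h3 : ContinuousAt (fun x : M => φ s x) p :=
          ContinuousAt.comp (f := fun x : M => (s, x)) hcs (by fun_prop)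
        exact ContinuousAt.comp (f := fun x : ℝ × M => x.2) h3 continuousAt_snd
      refine (ContinuousAt.comp (f := fun x : ℝ × M => (x.1 - s, φ s x.2)) h1 h2).congr
        (Eventually.of_forall fun x => ?_)
      simp only [Function.comp_apply, Function.uncurry]
      rw [← hφ.add hG hr hinj hT, sub_add_cancel]
    filter_upwards [(hφ.continuous_curve p).continuousAt.preimage_mem_nhds hU,
      Metric.ball_mem_nhds t₁ hε] with s hsU hs
    rw [Metric.mem_ball, Real.dist_eq] at hs
    exact ⟨hmove _ _ (mem_of_mem_nhds hU) hs, hmove _ _ hsU (by rwa [abs_sub_comm])⟩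
  have h0 : ContinuousAt (Function.uncurry φ) (0, p) := by
    obtain ⟨ε, hε, U, hU, hc⟩ := hlocal p
    exact hc 0 (by simpa using hε) p (mem_of_mem_nhds hU)
  exact (PreconnectedSpace.induction₂' P
    (fun t₁ => (hstep t₁).mono fun s h => ⟨h, Iff.symm h⟩)
    ⟨fun _ _ _ h h' => Iff.trans h h'⟩ 0 t).1 h0

/-- A lift of a `C^r` flow through a `C^r` immersion is `C^r`. -/
theorem contMDiff (hφ : IsFlowLift G T φ) (hG : ContMDiff 𝓘(ℝ, H) 𝓘(ℝ, V) r G)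
    (hr : r ≠ 0) (hinj : ∀ p, Function.Injective (mfderiv 𝓘(ℝ, H) 𝓘(ℝ, V) G p))
    (hTs : ContDiff ℝ r T) (hT0 : ∀ v, T (0, v) = v)
    (hT : ∀ s t v, T (s + t, v) = T (s, T (t, v))) :
    ContMDiff (𝓘(ℝ, ℝ).prod 𝓘(ℝ, H)) 𝓘(ℝ, H) r (Function.uncurry φ) := by
  intro x
  refine (hφ.continuous hG hr hinj hTs.continuous hT0 hT).continuousAt.contMDiffAt_of_comp_immersion
    hG hr (hinj _) ?_
  have h : G ∘ Function.uncurry φ = T ∘ fun x : ℝ × M => (x.1, G x.2) := by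
    ext x; exact hφ.lift x.1 x.2
  rw [h]
  exact hTs.contMDiff.contMDiffAt.comp x
    (contMDiffAt_fst.prodMk_space (hG.contMDiffAt.comp x contMDiffAt_snd))

end IsFlowLift

end FlowLifting

/-! ### Regular level sets as manifolds -/

section LevelSets

/-- A nonzero linear functional is the first component of linear coordinates. -/
theorem exists_equiv_eq_prod_of_surjective {H K : Type*} [NormedAddCommGroup H] [NormedSpace ℝ H]
    [NormedAddCommGroup K] [NormedSpace ℝ K] [FiniteDimensional ℝ H] [FiniteDimensional ℝ K]
    (hdim : Module.finrank ℝ H = Module.finrank ℝ K + 1) (D : H →L[ℝ] ℝ)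
    (hD : Function.Surjective D) :
    ∃ (P : H →L[ℝ] K) (A : H ≃L[ℝ] ℝ × K), (A : H →L[ℝ] ℝ × K) = D.prod P := by
  obtain ⟨w, hw⟩ := hD 1
  have hker : Module.finrank ℝ (LinearMap.ker (D : H →ₗ[ℝ] ℝ)) = Module.finrank ℝ K := by
    have h1 := LinearMap.finrank_range_add_finrank_ker (D : H →ₗ[ℝ] ℝ)
    rw [LinearMap.range_eq_top.2 hD, finrank_top, Module.finrank_self] at h1
    omega
  let i := LinearEquiv.ofFinrankEq _ K hker
  -- `Q` is the projection to the kernel of `D` along `w`, where `D w = 1`.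
  let Q : H →ₗ[ℝ] LinearMap.ker (D : H →ₗ[ℝ] ℝ) :=
    LinearMap.codRestrict _ (LinearMap.id - (D : H →ₗ[ℝ] ℝ).smulRight w) fun v => by
      simp [hw]
  let B : H →ₗ[ℝ] ℝ × K := (D : H →ₗ[ℝ] ℝ).prod (i.toLinearMap ∘ₗ Q)
  have hB : Function.Injective B := by
    rw [← LinearMap.ker_eq_bot, LinearMap.ker_eq_bot']
    intro v hv
    have h1 : D v = 0 := congrArg Prod.fst hv
    have h2 : i (Q v) = 0 := congrArg Prod.snd hv
    have h3 : ((Q v : LinearMap.ker (D : H →ₗ[ℝ] ℝ)) : H) = 0 := by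
      rw [i.map_eq_zero_iff.1 h2]; rfl
    have h4 : v - D v • w = 0 := h3
    rwa [h1, zero_smul, sub_zero] at h4
  let A := (LinearEquiv.ofInjectiveOfFinrankEq B hB
    (by rw [hdim, Module.finrank_prod, Module.finrank_self, add_comm])).toContinuousLinearEquiv
  refine ⟨LinearMap.toContinuousLinearMap (i.toLinearMap ∘ₗ Q), A, ?_⟩
  ext v <;> rfl

variable {H : Type*} [NormedAddCommGroup H] [NormedSpace ℝ H]
  {K : Type*} [NormedAddCommGroup K] [NormedSpace ℝ K]
  {M : Type u} [TopologicalSpace M] [ChartedSpace H M] {r : ℕ∞ω} {τ : M → ℝ}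

/-- `0` is a regular value of the `C^r` function `τ`; its zero set will be modelled on `K`. -/
structure HasRegularZeroSet (H K : Type*) [NormedAddCommGroup H] [NormedSpace ℝ H]
    [FiniteDimensional ℝ H] [NormedAddCommGroup K] [NormedSpace ℝ K] [FiniteDimensional ℝ K]
    {M : Type*} [TopologicalSpace M] [ChartedSpace H M] (r : ℕ∞ω) (τ : M → ℝ) : Prop where
  contMDiff : ContMDiff 𝓘(ℝ, H) 𝓘(ℝ, ℝ) r τ
  ne_zero : r ≠ 0
  surjective : ∀ p, τ p = 0 → Function.Surjective (mfderiv 𝓘(ℝ, H) 𝓘(ℝ, ℝ) τ p)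
  finrank_eq : Module.finrank ℝ H = Module.finrank ℝ K + 1

/-- Coordinates of `M` near `p` with first component `τ`. -/
structure IsAdaptedChart (H : Type*) [NormedAddCommGroup H] [NormedSpace ℝ H]
    {K : Type*} [NormedAddCommGroup K] [NormedSpace ℝ K]
    {M : Type*} [TopologicalSpace M] [ChartedSpace H M] (r : ℕ∞ω) (τ : M → ℝ)
    (e : OpenPartialHomeomorph M (ℝ × K)) : Prop where
  contMDiffOn : ContMDiffOn 𝓘(ℝ, H) 𝓘(ℝ, ℝ × K) r e e.source
  contMDiffOn_symm : ContMDiffOn 𝓘(ℝ, ℝ × K) 𝓘(ℝ, H) r e.symm e.target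
  fst_eq : ∀ q ∈ e.source, (e q).1 = τ q

/-- The chart of the zero set of `τ` given by an adapted chart of the ambient manifold. -/
def IsAdaptedChart.restrict {e : OpenPartialHomeomorph M (ℝ × K)} (he : IsAdaptedChart H r τ e)
    (p : {q : M // τ q = 0}) : OpenPartialHomeomorph {q : M // τ q = 0} K :=
  have hmem : ∀ y, ((0 : ℝ), y) ∈ e.target → τ (e.symm (0, y)) = 0 := fun y hy => by
    rw [← he.fst_eq _ (e.map_target hy), e.right_inv hy]
  have hfst : ∀ q : {q : M // τ q = 0}, q.1 ∈ e.source → ((0 : ℝ), (e q).2) = e q := fun q hq =>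
    Prod.ext ((he.fst_eq _ hq).trans q.2).symm rfl
  open scoped Classical in
  { toFun := fun q => (e q).2
    -- Outside the target the value `p` is a dummy that makes the function total.
    invFun := fun y => if h : τ (e.symm (0, y)) = 0 then ⟨e.symm (0, y), h⟩ else p
    source := Subtype.val ⁻¹' e.source
    target := (fun y => ((0 : ℝ), y)) ⁻¹' e.target
    map_source' := fun q hq => by
      rw [mem_preimage, hfst q hq]; exact e.map_source hq
    map_target' := fun y hy => by
      rw [dif_pos (hmem y hy)]; exact e.map_target hy
    left_inv' := fun q hq => by
      have h : e.symm (0, (e q).2) = q := by rw [hfst q hq]; exact e.left_inv hq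
      rw [dif_pos (by rw [h]; exact q.2)]
      exact Subtype.ext h
    right_inv' := fun y hy => by
      simp only [dif_pos (hmem y hy)]
      rw [e.right_inv hy]
    open_source := e.open_source.preimage continuous_subtype_val
    open_target := e.open_target.preimage (by fun_prop)
    continuousOn_toFun := continuous_snd.comp_continuousOn
      (e.continuousOn.comp continuous_subtype_val.continuousOn fun _ h => h)
    continuousOn_invFun := by
      refine Topology.IsInducing.subtypeVal.continuousOn_iff.2 ?_
      refine (e.continuousOn_symm.comp (f := fun y : K => ((0 : ℝ), y))
        (by fun_prop) fun _ h => h).congr fun y hy => ?_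
      simp only [Function.comp_apply, dif_pos (hmem y hy)] }

theorem IsAdaptedChart.coe_restrict_symm {e : OpenPartialHomeomorph M (ℝ × K)}
    (he : IsAdaptedChart H r τ e) (p : {q : M // τ q = 0}) {y : K} (hy : ((0 : ℝ), y) ∈ e.target) :
    ((he.restrict p).symm y : M) = e.symm (0, y) := by
  have h : τ (e.symm (0, y)) = 0 := by
    rw [← he.fst_eq _ (e.map_target hy), e.right_inv hy]
  change ((dite _ _ _ : {q : M // τ q = 0}) : M) = _
  rw [dif_pos h]

variable [FiniteDimensional ℝ H] [FiniteDimensional ℝ K]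

/-- Complete `dτ` at `p` by a linear map `P` to an isomorphism onto `ℝ × K`. Then `τ` together with
`P` of the chart has invertible derivative at `p`, and the inverse function theorem applies. -/
theorem HasRegularZeroSet.exists_isAdaptedChart [IsManifold 𝓘(ℝ, H) r M]
    (hτ : HasRegularZeroSet H K r τ) {p : M} (hp : τ p = 0) :
    ∃ e : OpenPartialHomeomorph M (ℝ × K), p ∈ e.source ∧ IsAdaptedChart H r τ e := by
  have : CompleteSpace H := FiniteDimensional.complete ℝ H
  let D : H →L[ℝ] ℝ := mfderiv 𝓘(ℝ, H) 𝓘(ℝ, ℝ) τ p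
  obtain ⟨P, A, hA⟩ := exists_equiv_eq_prod_of_surjective hτ.finrank_eq D (hτ.surjective p hp)
  set φ := chartAt H p
  have hpφ : p ∈ φ.source := mem_chart_source H p
  have hτφ : ContDiffOn ℝ r (τ ∘ φ.symm) φ.target := by
    rw [← contMDiffOn_iff_contDiffOn]
    exact hτ.contMDiff.comp_contMDiffOn contMDiffOn_chart_symm
  have hD : HasFDerivAt (τ ∘ φ.symm) D (φ p) :=
    (hτ.contMDiff.mdifferentiable hτ.ne_zero p).hasMFDerivAt.hasFDerivAt_chart
  have hd : fderiv ℝ (fun x => ((τ ∘ φ.symm) x, P x)) (φ p) = D.prod P :=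
    (hD.prodMk P.hasFDerivAt).fderiv
  have key := (isLocalDiffeomorphAt_chartAt (r := r) p).comp _ _
    (ContDiffOn.isLocalDiffeomorphAt φ.open_target
      (hτφ.prodMk (P.contDiff.contDiffOn)) hτ.ne_zero (φ.map_source hpφ) ⟨A, hA.trans hd.symm⟩)
  have key' : IsLocalDiffeomorphAt 𝓘(ℝ, H) 𝓘(ℝ, ℝ × K) r (fun q => (τ q, P (φ q))) p := by
    refine key.congr_of_eventuallyEq ?_
    filter_upwards [φ.open_source.mem_nhds hpφ] with q hq
    simp only [Function.comp_apply]
    rw [φ.left_inv hq]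
  obtain ⟨e, hpe, he⟩ := key'
  refine ⟨e.toOpenPartialHomeomorph, hpe, e.contMDiffOn_toFun, e.contMDiffOn_invFun, fun q hq => ?_⟩
  exact (congrArg Prod.fst (he hq)).symm

namespace HasRegularZeroSet

/-- The zero set of a function with regular value `0`, as a manifold modelled on `K`. -/
def ZeroSet (_ : HasRegularZeroSet H K r τ) : Type u := {q : M // τ q = 0}

variable (hτ : HasRegularZeroSet H K r τ)

/-- The inclusion of the zero set. -/
def incl (p : hτ.ZeroSet) : M := p.1

theorem apply_incl (p : hτ.ZeroSet) : τ (hτ.incl p) = 0 := p.2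

instance : TopologicalSpace hτ.ZeroSet := inferInstanceAs (TopologicalSpace {q : M // τ q = 0})

instance [T2Space M] : T2Space hτ.ZeroSet := inferInstanceAs (T2Space {q : M // τ q = 0})

instance [SecondCountableTopology M] : SecondCountableTopology hτ.ZeroSet :=
  TopologicalSpace.Subtype.secondCountableTopology {q : M | τ q = 0}

theorem isInducing_incl : Topology.IsInducing hτ.incl := Topology.IsInducing.subtypeVal

variable [IsManifold 𝓘(ℝ, H) r M]

/-- A choice of an adapted chart at a point of the zero set. -/
def ambientChart (p : hτ.ZeroSet) : OpenPartialHomeomorph M (ℝ × K) :=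
  (hτ.exists_isAdaptedChart p.2).choose

theorem mem_ambientChart_source (p : hτ.ZeroSet) : hτ.incl p ∈ (hτ.ambientChart p).source :=
  (hτ.exists_isAdaptedChart p.2).choose_spec.1

theorem isAdaptedChart_ambientChart (p : hτ.ZeroSet) :
    IsAdaptedChart H r τ (hτ.ambientChart p) :=
  (hτ.exists_isAdaptedChart p.2).choose_spec.2

/-- The preferred chart of the zero set at a point. -/
def chart (p : hτ.ZeroSet) : OpenPartialHomeomorph hτ.ZeroSet K :=
  (hτ.isAdaptedChart_ambientChart p).restrict p

theorem incl_chart_symm (p : hτ.ZeroSet) {y : K} (hy : y ∈ (hτ.chart p).target) :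
    hτ.incl ((hτ.chart p).symm y) = (hτ.ambientChart p).symm (0, y) :=
  (hτ.isAdaptedChart_ambientChart p).coe_restrict_symm p hy

instance : ChartedSpace K hτ.ZeroSet where
  atlas := range hτ.chart
  chartAt := hτ.chart
  mem_chart_source p := hτ.mem_ambientChart_source p
  chart_mem_atlas p := mem_range_self p

theorem contMDiffOn_incl_chart_symm (p : hτ.ZeroSet) :
    ContMDiffOn 𝓘(ℝ, K) 𝓘(ℝ, H) r (fun y => hτ.incl ((hτ.chart p).symm y))
      (hτ.chart p).target := by
  have h : ContMDiffOn 𝓘(ℝ, K) 𝓘(ℝ, ℝ × K) r (fun y : K => ((0 : ℝ), y)) (hτ.chart p).target :=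
    (contDiff_const.prodMk contDiff_id).contMDiff.contMDiffOn
  exact ((hτ.isAdaptedChart_ambientChart p).contMDiffOn_symm.comp h fun _ h => h).congr
    fun y hy => hτ.incl_chart_symm p hy

/-- A transition map is the slice `y ↦ (0, y)`, followed by a change of adapted ambient charts and
the projection to `K`. -/
instance : IsManifold 𝓘(ℝ, K) r hτ.ZeroSet := by
  refine isManifold_of_contDiffOn _ _ _ ?_
  rintro _ _ ⟨p, rfl⟩ ⟨p', rfl⟩
  simp only [mfld_simps]
  rw [← contMDiffOn_iff_contDiffOn]
  have h1 := (hτ.contMDiffOn_incl_chart_symm p).mono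
    (inter_subset_left (t := (hτ.chart p).symm ⁻¹' (hτ.chart p').source))
  exact (contDiff_snd.contMDiff.comp_contMDiffOn
    ((hτ.isAdaptedChart_ambientChart p').contMDiffOn.comp h1 fun y hy => hy.2))

theorem contMDiff_incl : ContMDiff 𝓘(ℝ, K) 𝓘(ℝ, H) r hτ.incl := by
  intro p
  have h1 : ContMDiffAt 𝓘(ℝ, K) 𝓘(ℝ, K) r (hτ.chart p) p :=
    contMDiffAt_of_mem_maximalAtlas (IsManifold.chart_mem_maximalAtlas p) (mem_chart_source K p)
  have h2 : ContMDiffAt 𝓘(ℝ, K) 𝓘(ℝ, H) r (fun y => hτ.incl ((hτ.chart p).symm y))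
      (hτ.chart p p) :=
    (hτ.contMDiffOn_incl_chart_symm p).contMDiffAt ((hτ.chart p).open_target.mem_nhds
      ((hτ.chart p).map_source (mem_chart_source K p)))
  refine (h2.comp p h1).congr_of_eventuallyEq ?_
  filter_upwards [(hτ.chart p).open_source.mem_nhds (mem_chart_source K p)] with q hq
  simp only [Function.comp_apply]
  rw [(hτ.chart p).left_inv hq]

/-- A map into the zero set is `C^r` if it is `C^r` as a map into the ambient manifold. -/
theorem contMDiff_of_incl_comp {E₁ H₁ N : Type*} [NormedAddCommGroup E₁] [NormedSpace ℝ E₁]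
    [TopologicalSpace H₁] {I : ModelWithCorners ℝ E₁ H₁} [TopologicalSpace N] [ChartedSpace H₁ N]
    {f : N → hτ.ZeroSet} (hf : ContMDiff I 𝓘(ℝ, H) r (hτ.incl ∘ f)) :
    ContMDiff I 𝓘(ℝ, K) r f := by
  intro x
  rw [contMDiffAt_iff_target]
  refine ⟨(hτ.isInducing_incl.continuous_iff.2 hf.continuous).continuousAt, ?_⟩
  have h1 : ContMDiffAt 𝓘(ℝ, H) 𝓘(ℝ, ℝ × K) r (hτ.ambientChart (f x)) (hτ.incl (f x)) :=
    (hτ.isAdaptedChart_ambientChart (f x)).contMDiffOn.contMDiffAt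
      ((hτ.ambientChart (f x)).open_source.mem_nhds (hτ.mem_ambientChart_source (f x)))
  exact contDiff_snd.contMDiff.contMDiffAt.comp x (h1.comp x (hf x))

end HasRegularZeroSet

end LevelSets

/-! ### Lorentzian linear algebra and the null direction -/

section Minkowski

variable {n : ℕ}

/-- The space part of a vector of `ℝ^{n+1}_1`. -/
def spatial : E (n + 1) →L[ℝ] E n :=
  LinearMap.toContinuousLinearMap
    { toFun := fun v => WithLp.toLp 2 fun i => v i.succ
      map_add' := fun _ _ => rfl
      map_smul' := fun _ _ => rfl }

/-- The time coordinate of a vector of `ℝ^{n+1}_1`. -/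
def timeCoord : E (n + 1) →L[ℝ] ℝ := EuclideanSpace.proj 0

@[simp] theorem spatial_apply (v : E (n + 1)) (i : Fin n) : spatial v i = v i.succ := rfl

@[simp] theorem timeCoord_apply (v : E (n + 1)) : timeCoord v = v 0 := rfl

theorem ext_time_spatial {v w : E (n + 1)} (h0 : v 0 = w 0) (h : spatial v = spatial w) :
    v = w := by
  ext i
  refine Fin.cases h0 (fun j => ?_) i
  exact congrArg (fun x : E n => x j) h

@[simp] theorem spacetime_zero (t : ℝ) (x : E n) : spacetime t x 0 = t := rfl

@[simp] theorem spatial_spacetime (t : ℝ) (x : E n) : spatial (spacetime t x) = x := rfl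

theorem lorentz_eq (v w : E (n + 1)) :
    lorentz v w = -(v 0 * w 0) + inner ℝ (spatial v) (spatial w) := by
  simp [lorentz, PiLp.inner_apply, mul_comm]

theorem norm_sq_eq (v : E (n + 1)) : ‖v‖ ^ 2 = v 0 ^ 2 + ‖spatial v‖ ^ 2 := by
  simp [EuclideanSpace.norm_sq_eq, Fin.sum_univ_succ]

/-- The Lorentzian inner product as a continuous bilinear map. -/
def lorentzL : E (n + 1) →L[ℝ] E (n + 1) →L[ℝ] ℝ :=
  -(timeCoord.smulRight timeCoord) +
    ∑ i : Fin n, (EuclideanSpace.proj i.succ : E (n + 1) →L[ℝ] ℝ).smulRight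
      (EuclideanSpace.proj i.succ : E (n + 1) →L[ℝ] ℝ)

@[simp] theorem lorentzL_apply (v w : E (n + 1)) : lorentzL v w = lorentz v w := by
  simp [lorentzL, lorentz]

theorem lorentz_comm (v w : E (n + 1)) : lorentz v w = lorentz w v := by
  simp [lorentz, mul_comm]

/-- An isotropic subspace of the symplectic vector space `K × K`, given as the range of `(a, b)`,
has dimension at most `dim K`. -/
theorem exists_ne_zero_of_isotropic {V K : Type*} [AddCommGroup V] [Module ℝ V]
    [FiniteDimensional ℝ V] [NormedAddCommGroup K] [InnerProductSpace ℝ K] [FiniteDimensional ℝ K]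
    (hdim : Module.finrank ℝ K < Module.finrank ℝ V) (a b : V →ₗ[ℝ] K)
    (hab : ∀ v w, inner ℝ (b v) (a w) = inner ℝ (b w) (a v)) :
    ∃ v, v ≠ 0 ∧ a v = 0 ∧ b v = 0 := by
  by_contra! hno
  -- This is `a + i b` on the complexification: `(v, w) ↦ (a v - b w, b v + a w)`. By isotropy the
  -- cross terms of its squared norm cancel, so a common kernel of `a` and `b` that is trivial
  -- forces `S` to be injective, and `2 dim V ≤ 2 dim K`.
  let S : V × V →ₗ[ℝ] K × K :=
    (a.coprod (-b)).prod (b.coprod a)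
  have hS : Function.Injective S := by
    rw [← LinearMap.ker_eq_bot, LinearMap.ker_eq_bot']
    rintro ⟨v, w⟩ hvw
    have h1 : a v - b w = 0 := by
      have := congrArg Prod.fst hvw
      simpa [S, sub_eq_add_neg] using this
    have h2 : b v + a w = 0 := by
      have := congrArg Prod.snd hvw
      simpa [S] using this
    have hsum : ‖a v‖ ^ 2 + ‖b w‖ ^ 2 + (‖b v‖ ^ 2 + ‖a w‖ ^ 2) = 0 := by
      have e1 := norm_sub_sq_real (a v) (b w)
      have e2 := norm_add_sq_real (b v) (a w)
      rw [h1, norm_zero] at e1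
      rw [h2, norm_zero, hab, real_inner_comm] at e2
      linarith
    have hz : ∀ x : K, ‖x‖ ^ 2 = 0 → x = 0 := fun x hx => by simpa using hx
    have := sq_nonneg ‖a v‖
    have := sq_nonneg ‖b w‖
    have := sq_nonneg ‖b v‖
    have := sq_nonneg ‖a w‖
    have hv : v = 0 := by
      by_contra hv
      exact hno v hv (hz _ (by linarith)) (hz _ (by linarith))
    have hw : w = 0 := by
      by_contra hw
      exact hno w hw (hz _ (by linarith)) (hz _ (by linarith))
    rw [hv, hw]; rfl
  have := LinearMap.finrank_le_finrank_of_injective hS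
  rw [Module.finrank_prod, Module.finrank_prod] at this
  omega

/-- A Lagrangian subspace of the contact hyperplane at a null covector contains the null
direction: if `(A, B)` is an injective pair of linear maps from an `n`-dimensional space which is
isotropic and tangent to the incidence relations of `(F, ξ)`, then `(ξ, 0)` is in its range. -/
theorem exists_null_direction {V : Type*} [AddCommGroup V] [Module ℝ V] [FiniteDimensional ℝ V]
    (hV : Module.finrank ℝ V = n) {A B : V →ₗ[ℝ] E (n + 1)} {ξ : E (n + 1)} (hξ0 : ξ 0 = 1)
    (hξ : lorentz ξ ξ = 0) (hB0 : ∀ v, B v 0 = 0) (hA : ∀ v, lorentz ξ (A v) = 0)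
    (hB : ∀ v, lorentz ξ (B v) = 0) (hAB : ∀ v w, lorentz (B v) (A w) = lorentz (B w) (A v))
    (hinj : ∀ v, A v = 0 → B v = 0 → v = 0) : ∃ v, A v = ξ ∧ B v = 0 := by
  obtain ⟨ν, hν⟩ : ∃ ν, spatial ξ = ν := ⟨_, rfl⟩
  have hνν : inner ℝ ν ν = 1 := by
    rw [lorentz_eq, hξ0, hν] at hξ; linarith
  have hν0 : ν ≠ 0 := fun h => by simp [h] at hνν
  obtain ⟨K, hKmem, hK⟩ : ∃ K : Submodule ℝ (E n), (∀ x, inner ℝ ν x = 0 → x ∈ K) ∧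
      Module.finrank ℝ K + 1 = n := by
    refine ⟨(Submodule.span ℝ {ν})ᗮ,
      fun x hx => Submodule.mem_orthogonal_singleton_iff_inner_right.2 hx, ?_⟩
    have h1 := Submodule.finrank_add_finrank_orthogonal (Submodule.span ℝ {ν})
    rw [finrank_span_singleton hν0, finrank_euclideanSpace_fin] at h1
    omega
  have hbν : ∀ v, inner ℝ ν (spatial (B v)) = 0 := fun v => by
    have := hB v
    rw [lorentz_eq, hB0, hν] at this; linarith
  -- Subtracting `(A v 0) • ξ` from `A v` removes its time component and leaves a spatial vector
  -- orthogonal to `ν`. This is the reduction modulo the null direction.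
  have haν : ∀ v, inner ℝ ν (spatial (A v) - (A v 0) • ν) = 0 := fun v => by
    have := hA v
    rw [lorentz_eq, hξ0, hν] at this
    rw [inner_sub_right, inner_smul_right, hνν]; linarith
  obtain ⟨P, hP⟩ : ∃ P : E (n + 1) →ₗ[ℝ] E n, ∀ x, P x = spatial x - (x 0) • ν :=
    ⟨(spatial - timeCoord.smulRight ν : E (n + 1) →L[ℝ] E n), fun x => rfl⟩
  obtain ⟨a, ha_coe⟩ : ∃ a : V →ₗ[ℝ] K, ∀ v, (a v : E n) = spatial (A v) - (A v 0) • ν :=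
    ⟨LinearMap.codRestrict K (P ∘ₗ A) fun v => hKmem _ (by
      rw [LinearMap.comp_apply, hP]; exact haν v), fun v => hP (A v)⟩
  obtain ⟨b, hb_coe⟩ : ∃ b : V →ₗ[ℝ] K, ∀ v, (b v : E n) = spatial (B v) :=
    ⟨LinearMap.codRestrict K ((spatial : E (n + 1) →L[ℝ] E n).toLinearMap ∘ₗ B)
      fun v => hKmem _ (by rw [LinearMap.comp_apply]; exact hbν v), fun v => rfl⟩
  have hab : ∀ v w, inner ℝ (b v) (a w) = inner ℝ (b w) (a v) := by
    have key : ∀ v w, inner ℝ (b v) (a w) = lorentz (B v) (A w) := fun v w => by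
      rw [Submodule.coe_inner, ha_coe, hb_coe, inner_sub_right, inner_smul_right, lorentz_eq, hB0,
        real_inner_comm ν, hbν]
      ring
    intro v w
    rw [key, key, hAB]
  obtain ⟨v, hv0, hav, hbv⟩ := exists_ne_zero_of_isotropic (by omega) a b hab
  have hBv : B v = 0 := ext_time_spatial (hB0 v) (by
    rw [← hb_coe, hbv, map_zero]; rfl)
  have hAv : A v = (A v 0) • ξ := ext_time_spatial (by simp [hξ0]) (by
    rw [map_smul, hν, ← sub_eq_zero, ← ha_coe, hav]; rfl)
  -- The kernel vector satisfies `A v = c ξ` and `B v = 0`. Injectivity of the pair excludes `c =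
  -- 0`, so `v` can be rescaled.
  have hc : A v 0 ≠ 0 := fun h => hv0 (hinj v (by rw [hAv, h, zero_smul]) hBv)
  refine ⟨(A v 0)⁻¹ • v, ?_, by rw [map_smul, hBv, smul_zero]⟩
  rw [map_smul]
  nth_rewrite 2 [hAv]
  rw [smul_smul, inv_mul_cancel₀ hc, one_smul]

end Minkowski

/-! ### Smoothness of vector fields through immersions -/

section VectorFields

variable {H V : Type*} [NormedAddCommGroup H] [NormedSpace ℝ H]
  [NormedAddCommGroup V] [NormedSpace ℝ V]
  {M : Type*} [TopologicalSpace M] [ChartedSpace H M] {r : ℕ∞ω}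

/-- A map into the tangent bundle of a vector space is `C^r` if both components are. -/
theorem contMDiffAt_tangentBundle_of_components {E₁ H₁ N : Type*} [NormedAddCommGroup E₁]
    [NormedSpace ℝ E₁] [TopologicalSpace H₁] {I : ModelWithCorners ℝ E₁ H₁} [TopologicalSpace N]
    [ChartedSpace H₁ N] {f g : N → H} {x : N} (hf : ContMDiffAt I 𝓘(ℝ, H) r f x)
    (hg : ContMDiffAt I 𝓘(ℝ, H) r g x) :
    ContMDiffAt I 𝓘(ℝ, H).tangent r (fun y => (⟨f y, g y⟩ : TangentBundle 𝓘(ℝ, H) H)) x := by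
  rw [Bundle.contMDiffAt_totalSpace]
  refine ⟨hf, ?_⟩
  convert! hg with y
  simp

/-- A vector field which is mapped by a `C^r` immersion to a `C^r` field along it is `C^r`. -/
theorem contMDiff_section_of_mfderiv_immersion [FiniteDimensional ℝ V]
    [FiniteDimensional ℝ H] [IsManifold 𝓘(ℝ, H) r M] [IsManifold 𝓘(ℝ, H) 1 M]
    (hr : r + 1 ≤ r) {G w : M → V} (hG : ContMDiff 𝓘(ℝ, H) 𝓘(ℝ, V) r G)
    (hinj : ∀ p, Function.Injective (mfderiv 𝓘(ℝ, H) 𝓘(ℝ, V) G p))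
    (hw : ContMDiff 𝓘(ℝ, H) 𝓘(ℝ, V) r w) (X : (p : M) → TangentSpace 𝓘(ℝ, H) p)
    (hX : ∀ p, (mfderiv 𝓘(ℝ, H) 𝓘(ℝ, V) G p (X p) : V) = w p) :
    ContMDiff 𝓘(ℝ, H) 𝓘(ℝ, H).tangent r (fun p => (⟨p, X p⟩ : TangentBundle 𝓘(ℝ, H) M)) := by
  have hr0 : r ≠ 0 := by rintro rfl; simp at hr
  intro p
  obtain ⟨ℓ, e, hp, he⟩ := exists_isLocalDiffeomorphAt_of_injective_mfderiv hG hr0 p (hinj p)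
  let f : M → H := ℓ ∘ G
  have hf : ContMDiff 𝓘(ℝ, H) 𝓘(ℝ, H) r f := ℓ.contMDiff.comp hG
  let e' := e.toOpenPartialHomeomorph
  let g : H → M := e'.symm
  have hg : ContMDiffOn 𝓘(ℝ, H) 𝓘(ℝ, H) r g e'.target := e.contMDiffOn_invFun
  have hfe : ∀ q ∈ e'.source, f q ∈ e'.target := fun q hq => by
    rw [show f q = e' q from he hq]; exact e'.map_source hq
  have hgf : ∀ q ∈ e'.source, g (f q) = q := fun q hq => by
    rw [show f q = e' q from he hq]; exact e'.left_inv hq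
  -- Near `p` the field `X` is the image under the tangent map of the local inverse `g` of the `C^r`
  -- field `ℓ ∘ w` along `f`. That tangent map is again `C^r` because `r + 1 ≤ r`.
  have hXq : ∀ q ∈ e'.source, (⟨q, X q⟩ : TangentBundle 𝓘(ℝ, H) M) =
      tangentMapWithin 𝓘(ℝ, H) 𝓘(ℝ, H) g e'.target
        (⟨f q, ℓ (w q)⟩ : TangentBundle 𝓘(ℝ, H) H) := by
    intro q hq
    have hgd : MDifferentiableAt 𝓘(ℝ, H) 𝓘(ℝ, H) g (f q) :=
      (hg.contMDiffAt (e'.open_target.mem_nhds (hfe q hq))).mdifferentiableAt hr0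
    have h1 : tangentMap 𝓘(ℝ, H) 𝓘(ℝ, H) f ⟨q, X q⟩ = ⟨f q, ℓ (w q)⟩ := by
      have h3 : mfderiv 𝓘(ℝ, H) 𝓘(ℝ, H) f q (X q) = ℓ (w q) := by
        rw [mfderiv_comp q ℓ.mdifferentiableAt (hG.mdifferentiable hr0 q),
          ContinuousLinearMap.mfderiv_eq, ← hX q]
        rfl
      rw [← h3]; rfl
    rw [tangentMapWithin_eq_tangentMap (e'.open_target.uniqueMDiffOn _ (hfe q hq)) hgd, ← h1,
      ← tangentMap_comp_at _ hgd (hf.mdifferentiable hr0 q)]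
    have h2 : g ∘ f =ᶠ[𝓝 q] id := by
      filter_upwards [e'.open_source.mem_nhds hq] with y hy
      exact hgf y hy
    have h4 : tangentMap 𝓘(ℝ, H) 𝓘(ℝ, H) (g ∘ f) ⟨q, X q⟩ =
        tangentMap 𝓘(ℝ, H) 𝓘(ℝ, H) id ⟨q, X q⟩ := by
      simp only [tangentMap]
      rw [h2.mfderiv_eq]
      exact Bundle.TotalSpace.ext (hgf q hq) (HEq.rfl)
    rw [h4, tangentMap_id]; rfl
  have hsec : ContMDiffAt 𝓘(ℝ, H) 𝓘(ℝ, H).tangent r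
      (fun q => (⟨f q, ℓ (w q)⟩ : TangentBundle 𝓘(ℝ, H) H)) p :=
    contMDiffAt_tangentBundle_of_components hf.contMDiffAt (ℓ.contMDiff.comp hw).contMDiffAt
  have htan := (hg.contMDiffOn_tangentMapWithin hr e'.open_target.uniqueMDiffOn).contMDiffAt
    ((e'.open_target.preimage (FiberBundle.continuous_proj H (TangentSpace 𝓘(ℝ, H)))).mem_nhds
      (x := (⟨f p, ℓ (w p)⟩ : TangentBundle 𝓘(ℝ, H) H)) (hfe p hp))
  refine (htan.comp p hsec).congr_of_eventuallyEq ?_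
  filter_upwards [e'.open_source.mem_nhds hp] with q hq
  exact hXq q hq

end VectorFields

/-! ### Symmetry from the Legendrian condition -/

section Isotropy

variable {H V : Type*} [NormedAddCommGroup H] [NormedSpace ℝ H]
  [NormedAddCommGroup V] [NormedSpace ℝ V]
  {M : Type*} [TopologicalSpace M] [ChartedSpace H M] {r : ℕ∞ω} [IsManifold 𝓘(ℝ, H) r M]

/-- Legendrian immersions are isotropic: differentiating the incidence relation `L(ξ, dF) = 0`
shows that `L(dξ, dF)` is symmetric. -/
theorem bilin_mfderiv_symm_of_orthogonal (hr : 2 ≤ r) (L : V →L[ℝ] V →L[ℝ] ℝ) {F ξ : M → V}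
    (hF : ContMDiff 𝓘(ℝ, H) 𝓘(ℝ, V) r F) (hξ : ContMDiff 𝓘(ℝ, H) 𝓘(ℝ, V) r ξ)
    (horth : ∀ p v, L (ξ p) (mfderiv 𝓘(ℝ, H) 𝓘(ℝ, V) F p v) = 0) (p : M)
    (v w : TangentSpace 𝓘(ℝ, H) p) :
    L (mfderiv 𝓘(ℝ, H) 𝓘(ℝ, V) ξ p v) (mfderiv 𝓘(ℝ, H) 𝓘(ℝ, V) F p w) =
      L (mfderiv 𝓘(ℝ, H) 𝓘(ℝ, V) ξ p w) (mfderiv 𝓘(ℝ, H) 𝓘(ℝ, V) F p v) := by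
  have hr0 : r ≠ 0 := by rintro rfl; simp at hr
  set φ := chartAt H p
  have hpφ : φ p ∈ φ.target := φ.map_source (mem_chart_source H p)
  have hsm : ∀ f : M → V, ContMDiff 𝓘(ℝ, H) 𝓘(ℝ, V) r f →
      ContDiffOn ℝ r (f ∘ φ.symm) φ.target := fun f hf => by
    rw [← contMDiffOn_iff_contDiffOn]
    exact hf.comp_contMDiffOn contMDiffOn_chart_symm
  have hrel : ∀ x ∈ φ.target, ∀ u, L (ξ (φ.symm x)) (fderiv ℝ (F ∘ φ.symm) x u) = 0 := by
    intro x hx u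
    have h1 : MDifferentiableAt 𝓘(ℝ, H) 𝓘(ℝ, H) φ.symm x :=
      (contMDiffOn_chart_symm.contMDiffAt (φ.open_target.mem_nhds hx)).mdifferentiableAt hr0
    rw [← mfderiv_eq_fderiv, mfderiv_comp x (hF.mdifferentiable hr0 _) h1]
    exact horth _ _
  obtain ⟨A, hA, hDF⟩ : ∃ A : H →L[ℝ] V, A = mfderiv 𝓘(ℝ, H) 𝓘(ℝ, V) F p ∧
      HasFDerivAt (F ∘ φ.symm) A (φ p) :=
    ⟨_, rfl, (hF.mdifferentiable hr0 p).hasMFDerivAt.hasFDerivAt_chart⟩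
  obtain ⟨B, hB, hDξ⟩ : ∃ B : H →L[ℝ] V, B = mfderiv 𝓘(ℝ, H) 𝓘(ℝ, V) ξ p ∧
      HasFDerivAt (ξ ∘ φ.symm) B (φ p) :=
    ⟨_, rfl, (hξ.mdifferentiable hr0 p).hasMFDerivAt.hasFDerivAt_chart⟩
  have hFat : ContDiffAt ℝ r (F ∘ φ.symm) (φ p) :=
    (hsm F hF).contDiffAt (φ.open_target.mem_nhds hpφ)
  have hDDF : HasFDerivAt (fderiv ℝ (F ∘ φ.symm))
      (fderiv ℝ (fderiv ℝ (F ∘ φ.symm)) (φ p)) (φ p) :=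
    ((hFat.fderiv_right (m := 1) (by simpa [one_add_one_eq_two] using hr)).differentiableAt
      one_ne_zero).hasFDerivAt
  have hsymm := hFat.isSymmSndFDerivAt (by simpa using hr)
  have hbase : φ.symm (φ p) = p := φ.left_inv (mem_chart_source H p)
  -- Differentiate `L(ξ, dF(b)) = 0` in the direction `a`. The right side is symmetric in `a` and
  -- `b`, being a second derivative.
  have key : ∀ a b : H, L (B a) (A b) =
      -L (ξ p) (fderiv ℝ (fderiv ℝ (F ∘ φ.symm)) (φ p) a b) := by
    intro a b
    have h1 : HasFDerivAt (fun x => L ((ξ ∘ φ.symm) x) (fderiv ℝ (F ∘ φ.symm) x b)) _ (φ p) :=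
      (L.hasFDerivAt.comp (φ p) hDξ).clm_apply (hDDF.clm_apply (hasFDerivAt_const b (φ p)))
    have h2 : HasFDerivAt (fun x => L ((ξ ∘ φ.symm) x) (fderiv ℝ (F ∘ φ.symm) x b))
        (0 : H →L[ℝ] ℝ) (φ p) := by
      refine (hasFDerivAt_const (0 : ℝ) (φ p)).congr_of_eventuallyEq ?_
      filter_upwards [φ.open_target.mem_nhds hpφ] with x hx
      exact hrel x hx b
    have h3 := congrArg (fun D : H →L[ℝ] ℝ => D a) (h1.unique h2)
    simp [hbase, hDF.fderiv] at h3
    linarith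
  rw [← hA, ← hB]
  exact (key v w).trans ((congrArg (fun x => -L (ξ p) x) (hsymm v w)).trans (key w v).symm)

end Isotropy

/-! ### Lifts of the Gauss map and the normalized null normal -/

section NullFronts

/-- The chain rule for a map from a manifold to a vector space followed by a map of vector
spaces. -/
theorem mfderiv_comp_apply_of_hasFDerivAt {H V W : Type*} [NormedAddCommGroup H] [NormedSpace ℝ H]
    [NormedAddCommGroup V] [NormedSpace ℝ V] [NormedAddCommGroup W] [NormedSpace ℝ W]
    {M : Type*} [TopologicalSpace M] [ChartedSpace H M] {g : V → W} {g' : V →L[ℝ] W} {G : M → V}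
    {p : M} (hg : HasFDerivAt g g' (G p)) (hG : MDifferentiableAt 𝓘(ℝ, H) 𝓘(ℝ, V) G p)
    (v : TangentSpace 𝓘(ℝ, H) p) :
    (mfderiv 𝓘(ℝ, H) 𝓘(ℝ, W) (fun q => g (G q)) p v : W) =
      g' (mfderiv 𝓘(ℝ, H) 𝓘(ℝ, V) G p v : V) := by
  have h := (hg.hasMFDerivAt.comp p hG.hasMFDerivAt).mfderiv
  exact congrArg (fun D : H →L[ℝ] W => D v) h

/-- Differentiation commutes with continuous linear maps. -/
theorem mfderiv_clm_comp_apply {H V W : Type*} [NormedAddCommGroup H] [NormedSpace ℝ H]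
    [NormedAddCommGroup V] [NormedSpace ℝ V] [NormedAddCommGroup W] [NormedSpace ℝ W]
    {M : Type*} [TopologicalSpace M] [ChartedSpace H M] (ℓ : V →L[ℝ] W) {G : M → V} {p : M}
    (hG : MDifferentiableAt 𝓘(ℝ, H) 𝓘(ℝ, V) G p) (v : TangentSpace 𝓘(ℝ, H) p) :
    (mfderiv 𝓘(ℝ, H) 𝓘(ℝ, W) (fun q => ℓ (G q)) p v : W) =
      ℓ (mfderiv 𝓘(ℝ, H) 𝓘(ℝ, V) G p v : V) :=
  mfderiv_comp_apply_of_hasFDerivAt ℓ.hasFDerivAt hG v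

theorem mfderiv_apply_eq_zero_of_const {H V : Type*} [NormedAddCommGroup H] [NormedSpace ℝ H]
    [NormedAddCommGroup V] [NormedSpace ℝ V] {M : Type*} [TopologicalSpace M] [ChartedSpace H M]
    {G : M → V} {c : V} (hG : ∀ p, G p = c) (p : M) (v : TangentSpace 𝓘(ℝ, H) p) :
    (mfderiv 𝓘(ℝ, H) 𝓘(ℝ, V) G p v : V) = 0 := by
  obtain rfl : G = fun _ => c := funext hG
  rw [mfderiv_const]; rfl

/-- A map on which a symmetric bilinear form is constant is orthogonal to its derivative. -/
theorem bilin_mfderiv_eq_zero_of_const {H V : Type*} [NormedAddCommGroup H] [NormedSpace ℝ H]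
    [NormedAddCommGroup V] [NormedSpace ℝ V] {M : Type*} [TopologicalSpace M] [ChartedSpace H M]
    (L : V →L[ℝ] V →L[ℝ] ℝ) (hL : ∀ x y, L x y = L y x) {G : M → V} {c : ℝ}
    (hc : ∀ p, L (G p) (G p) = c) {p : M} (hG : MDifferentiableAt 𝓘(ℝ, H) 𝓘(ℝ, V) G p)
    (v : TangentSpace 𝓘(ℝ, H) p) : L (G p) (mfderiv 𝓘(ℝ, H) 𝓘(ℝ, V) G p v : V) = 0 := by
  have h1 : HasFDerivAt (fun x => L x x) ((2 : ℝ) • L (G p)) (G p) := by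
    convert! L.hasFDerivAt.clm_apply (hasFDerivAt_id (G p)) using 1
    ext w
    simp [hL w, two_mul]
  have h2 := mfderiv_comp_apply_of_hasFDerivAt h1 hG v
  rw [mfderiv_apply_eq_zero_of_const hc] at h2
  exact (mul_eq_zero.1 h2.symm).resolve_left two_ne_zero

variable {n m k : ℕ} {M : Type*} [TopologicalSpace M] [ChartedSpace (E n) M] {r : ℕ∞ω}

/-- The representative chosen by `rep` is arbitrary; this comparison moves conditions stated for it
to the smooth lift. -/
theorem IsLift.exists_rep_eq {α : M → PDual k} {φ : M → StrongDual ℝ (E k)}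
    (hφ : IsLift n r α φ) (p : M) : ∃ a : ℝ, a ≠ 0 ∧ (α p).rep = a • φ p := by
  obtain ⟨h, hp⟩ := hφ.2 p
  obtain ⟨a, ha⟩ := Projectivization.exists_smul_eq_mk_rep ℝ (φ p) h
  exact ⟨a, a.ne_zero, by rw [hp]; exact ha.symm⟩

theorem IsLift.apply_mfderiv_eq_zero {F : M → E k} {α : M → PDual k}
    {φ : M → StrongDual ℝ (E k)} (hF : IsFrontal n r F α) (hφ : IsLift n r α φ) (p : M)
    (v : TangentSpace (𝓡 n) p) : φ p (mfderiv (𝓡 n) (𝓡 k) F p v : E k) = 0 := by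
  obtain ⟨a, ha, hp⟩ := hφ.exists_rep_eq p
  have h := hF.2.2 p v
  rw [hp] at h
  exact (mul_eq_zero.1 h).resolve_left ha

theorem IsLift.affineChart_eq {α : M → PDual k} {φ : M → StrongDual ℝ (E k)}
    (hφ : IsLift n r α φ) (e : E k) (p : M) : affineChart e (α p) = (φ p e)⁻¹ • φ p := by
  obtain ⟨h, hp⟩ := hφ.2 p
  rw [hp, affineChart_mk]

theorem IsLift.rep_apply_ne_zero_iff {α : M → PDual k} {φ : M → StrongDual ℝ (E k)}
    (hφ : IsLift n r α φ) (e : E k) (p : M) : (α p).rep e ≠ 0 ↔ φ p e ≠ 0 := by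
  obtain ⟨a, ha, hp⟩ := hφ.exists_rep_eq p
  rw [hp]
  exact ⟨fun h h' => h (by simp [h']), fun h => mul_ne_zero ha h⟩

/-- A map with a `C^r` lift is `C^r` as a map to the projective space. -/
theorem IsLift.isProjSmooth {α : M → PDual k} {φ : M → StrongDual ℝ (E k)}
    (hφ : IsLift n r α φ) : IsProjSmooth n r α := by
  intro p e he
  have h0 := (hφ.rep_apply_ne_zero_iff e p).1 he
  have h1 : ContMDiffAt (𝓡 n) 𝓘(ℝ, ℝ) r (fun q => φ q e) p :=
    (ContinuousLinearMap.apply ℝ ℝ e).contMDiff.contMDiffAt.comp p (hφ.1 p)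
  have h2 : ContMDiffAt (𝓡 n) 𝓘(ℝ, ℝ) r (fun q => (φ q e)⁻¹) p :=
    ContMDiffAt.comp p (contDiffAt_inv ℝ h0).contMDiffAt h1
  exact (h2.smul (hφ.1 p)).congr_of_eventuallyEq (Eventually.of_forall (hφ.affineChart_eq e))

/-- If the time component vanished, nullity would force the space part to have norm zero. This
permits division by the time component. -/
theorem lorentz_ne_zero_of_null {ξ : E (m + 1)} (hξ : lorentz ξ ξ = 0) (h0 : ξ ≠ 0) : ξ 0 ≠ 0 := by
  intro h
  refine h0 (ext_time_spatial h ?_)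
  rw [lorentz_eq, h, real_inner_self_eq_norm_sq] at hξ
  simpa using hξ

/-- A null front has a null normal field with time component `1`. -/
theorem IsNullFront.exists_normalField {F : M → E (m + 1)} {α : M → PDual (m + 1)}
    (hF : IsNullFront n r F α) :
    ∃ ξ : M → E (m + 1), ContMDiff (𝓡 n) (𝓡 (m + 1)) r ξ ∧
      IsLift n r α (fun p => lorentzL (ξ p)) ∧ (∀ p, ξ p 0 = 1) ∧
      ∀ p, lorentz (ξ p) (ξ p) = 0 := by
  obtain ⟨-, ξ, ⟨hξ, φ, hφ, hξφ⟩, hnull⟩ := hF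
  have hne : ∀ p, ξ p 0 ≠ 0 := fun p => by
    refine lorentz_ne_zero_of_null (hnull p) fun h => ?_
    obtain ⟨h', -⟩ := hφ.2 p
    refine h' (ContinuousLinearMap.ext fun x => ?_)
    rw [← hξφ, h]; simp [lorentz]
  have hsm : ContMDiff (𝓡 n) (𝓡 (m + 1)) r fun p => (ξ p 0)⁻¹ • ξ p := by
    intro p
    have h1 : ContMDiffAt (𝓡 n) 𝓘(ℝ, ℝ) r (fun q => ξ q 0) p :=
      timeCoord.contMDiff.contMDiffAt.comp p (hξ p)
    exact (ContMDiffAt.comp p (contDiffAt_inv ℝ (hne p)).contMDiffAt h1).smul (hξ p)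
  have hL : ∀ p, lorentzL ((ξ p 0)⁻¹ • ξ p) = (ξ p 0)⁻¹ • φ p := fun p => by
    ext x; rw [map_smul, smul_apply, smul_apply,
      lorentzL_apply, hξφ]
  refine ⟨_, hsm, ⟨lorentzL.contMDiff.comp hsm, fun p => ?_⟩, fun p => ?_, fun p => ?_⟩
  · obtain ⟨h', hp⟩ := hφ.2 p
    have hnz : lorentzL ((ξ p 0)⁻¹ • ξ p) ≠ 0 := by
      rw [hL]; exact smul_ne_zero (inv_ne_zero (hne p)) h'
    refine ⟨hnz, ?_⟩
    rw [hp, Projectivization.mk_eq_mk_iff']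
    refine ⟨ξ p 0, ?_⟩
    change ξ p 0 • lorentzL ((ξ p 0)⁻¹ • ξ p) = φ p
    rw [hL, smul_smul, mul_inv_cancel₀ (hne p), one_smul]
  · exact inv_mul_cancel₀ (hne p)
  · rw [← lorentzL_apply, map_smul, map_smul, smul_apply, lorentzL_apply,
      hnull, smul_zero, smul_zero]

/-- The space part has norm `1` by nullity, so the squared Euclidean length is `1 + 1`. Fields
scaled to time component `1` are therefore those to which `L`-completeness refers. -/
theorem isENormalized_of_time_eq_one {α : M → PDual (m + 1)} {ξ : M → E (m + 1)}
    (hξ : ContMDiff (𝓡 n) (𝓡 (m + 1)) r ξ) (hlift : IsLift n r α (fun p => lorentzL (ξ p)))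
    (h1 : ∀ p, ξ p 0 = 1) (hnull : ∀ p, lorentz (ξ p) (ξ p) = 0) : IsENormalized n r α ξ := by
  refine ⟨⟨hξ, _, hlift, fun p x => (lorentzL_apply _ _).symm⟩, fun p => ⟨?_, ?_⟩⟩
  · rw [h1]; exact one_pos
  · have h2 := hnull p
    rw [lorentz_eq, h1, real_inner_self_eq_norm_sq] at h2
    have h3 := norm_sq_eq (ξ p)
    rw [h1] at h3
    rw [← Real.sqrt_sq (norm_nonneg (ξ p)), h3]
    congr 1
    linarith

/-- The pair of a null front and its normalized null normal field is an immersion. -/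
theorem IsFront.injective_mfderiv_prod {F : M → E (m + 1)} {α : M → PDual (m + 1)}
    (hF : IsFront n r F α) (hr : r ≠ 0) {ξ : M → E (m + 1)}
    (hξ : ContMDiff (𝓡 n) (𝓡 (m + 1)) r ξ)
    (hlift : IsLift n r α (fun p => lorentzL (ξ p))) (h1 : ∀ p, ξ p 0 = 1) (p : M) :
    Function.Injective
      (mfderiv (𝓡 n) 𝓘(ℝ, E (m + 1) × E (m + 1)) (fun q => (F q, ξ q)) p) := by
  -- The time axis pairs with `ξ` to the constant `-1`, so a single affine chart covers the image of
  -- `α`, and in it `α` is minus the covector of `ξ`: a linear function of `ξ`.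
  let e : E (m + 1) := spacetime 1 0
  have hval : ∀ q, lorentzL (ξ q) e = -1 := fun q => by
    have : spatial e = 0 := spatial_spacetime _ _
    rw [lorentzL_apply, lorentz_eq, h1, this, inner_zero_right]
    simp [e]
  have hne : (α p).rep e ≠ 0 := (hlift.rep_apply_ne_zero_iff e p).2 (by rw [hval]; norm_num)
  have hinj := hF.2 p e hne
  let Λ : E (m + 1) × E (m + 1) →L[ℝ] E (m + 1) × StrongDual ℝ (E (m + 1)) :=
    (ContinuousLinearMap.id ℝ _).prodMap (-lorentzL)
  have hΛ : (fun q => (F q, affineChart e (α q))) = fun q => Λ (F q, ξ q) := by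
    funext q
    rw [hlift.affineChart_eq, hval]
    refine Prod.ext rfl (ContinuousLinearMap.ext fun x => ?_)
    change (-1 : ℝ)⁻¹ * lorentzL (ξ q) x = -lorentzL (ξ q) x
    rw [inv_neg_one, neg_one_mul]
  rw [hΛ] at hinj
  have hG : MDifferentiableAt (𝓡 n) 𝓘(ℝ, E (m + 1) × E (m + 1)) (fun q => (F q, ξ q)) p :=
    ((hF.1.1.prodMk_space hξ).mdifferentiable hr) p
  intro v w hvw
  refine hinj ?_
  have hv := mfderiv_clm_comp_apply Λ hG v
  have hw := mfderiv_clm_comp_apply Λ hG w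
  exact hv.trans ((congrArg Λ hvw).trans hw.symm)

end NullFronts

/-! ### The complete null flow -/

section NullFlow

variable {n : ℕ} {M : Type*} [TopologicalSpace M] [ChartedSpace (E n) M] {r : ℕ∞ω}

/-- The derivative of a vector-valued function along a curve. -/
theorem HasMFDerivAt.hasDerivAt_comp {H V M : Type*} [NormedAddCommGroup H] [NormedSpace ℝ H]
    [NormedAddCommGroup V] [NormedSpace ℝ V] [TopologicalSpace M] [ChartedSpace H M] {γ : ℝ → M}
    {s : ℝ} {v : TangentSpace 𝓘(ℝ, H) (γ s)}
    (hγ : HasMFDerivAt 𝓘(ℝ, ℝ) 𝓘(ℝ, H) γ s ((1 : ℝ →L[ℝ] ℝ).smulRight v)) {f : M → V}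
    (hf : MDifferentiableAt 𝓘(ℝ, H) 𝓘(ℝ, V) f (γ s)) :
    HasDerivAt (f ∘ γ) (mfderiv 𝓘(ℝ, H) 𝓘(ℝ, V) f (γ s) v : V) s := by
  let D : ℝ →L[ℝ] V := (mfderiv 𝓘(ℝ, H) 𝓘(ℝ, V) f (γ s)).comp ((1 : ℝ →L[ℝ] ℝ).smulRight v)
  have h1 : HasFDerivAt (f ∘ γ) D s := (hf.hasMFDerivAt.comp s hγ).hasFDerivAt
  refine h1.hasDerivAt.congr_deriv ?_
  change mfderiv 𝓘(ℝ, H) 𝓘(ℝ, V) f (γ s) ((1 : ℝ) • v) = _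
  rw [one_smul]

/-- The data of a null front with its normalized null normal field, as used for the construction
of the null flow. -/
structure IsNormalizedNullPair (n : ℕ) {M : Type*} [TopologicalSpace M] [ChartedSpace (E n) M]
    (r : ℕ∞ω) (F ξ : M → E (n + 1)) : Prop where
  smooth_front : ContMDiff (𝓡 n) (𝓡 (n + 1)) r F
  smooth_normal : ContMDiff (𝓡 n) (𝓡 (n + 1)) r ξ
  time_eq_one : ∀ p, ξ p 0 = 1
  null : ∀ p, lorentz (ξ p) (ξ p) = 0
  orthogonal : ∀ p v, lorentz (ξ p) (mfderiv (𝓡 n) (𝓡 (n + 1)) F p v : E (n + 1)) = 0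
  injective : ∀ p, Function.Injective
    (mfderiv (𝓡 n) 𝓘(ℝ, E (n + 1) × E (n + 1)) (fun q => (F q, ξ q)) p)

namespace IsNormalizedNullPair

variable {F ξ : M → E (n + 1)}

theorem smooth_prod (h : IsNormalizedNullPair n r F ξ) :
    ContMDiff (𝓡 n) 𝓘(ℝ, E (n + 1) × E (n + 1)) r (fun q => (F q, ξ q)) :=
  h.smooth_front.prodMk_space h.smooth_normal

theorem mfderiv_prod (h : IsNormalizedNullPair n r F ξ) (hr : r ≠ 0) (p : M)
    (v : TangentSpace (𝓡 n) p) :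
    (mfderiv (𝓡 n) 𝓘(ℝ, E (n + 1) × E (n + 1)) (fun q => (F q, ξ q)) p v :
      E (n + 1) × E (n + 1)) =
      ((mfderiv (𝓡 n) (𝓡 (n + 1)) F p v : E (n + 1)),
        (mfderiv (𝓡 n) (𝓡 (n + 1)) ξ p v : E (n + 1))) :=
  Prod.ext
    (mfderiv_clm_comp_apply (ContinuousLinearMap.fst ℝ _ _)
      (h.smooth_prod.mdifferentiable hr p) v).symm
    (mfderiv_clm_comp_apply (ContinuousLinearMap.snd ℝ _ _)
      (h.smooth_prod.mdifferentiable hr p) v).symm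

/-- The null direction of a null front is tangent to the source manifold, also at singular
points. -/
theorem exists_tangent_null (h : IsNormalizedNullPair n r F ξ) [IsManifold (𝓡 n) r M]
    (hr : 2 ≤ r) (p : M) :
    ∃ v : TangentSpace (𝓡 n) p, (mfderiv (𝓡 n) (𝓡 (n + 1)) F p v : E (n + 1)) = ξ p ∧
      (mfderiv (𝓡 n) (𝓡 (n + 1)) ξ p v : E (n + 1)) = 0 := by
  have hr0 : r ≠ 0 := by rintro rfl; simp at hr
  have hξd := h.smooth_normal.mdifferentiable hr0 p
  obtain ⟨A, hA⟩ : ∃ A : E n →L[ℝ] E (n + 1), A = mfderiv (𝓡 n) (𝓡 (n + 1)) F p := ⟨_, rfl⟩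
  obtain ⟨B, hB⟩ : ∃ B : E n →L[ℝ] E (n + 1), B = mfderiv (𝓡 n) (𝓡 (n + 1)) ξ p := ⟨_, rfl⟩
  have hAv : ∀ v : E n, A v = (mfderiv (𝓡 n) (𝓡 (n + 1)) F p v : E (n + 1)) := fun v =>
    congrArg (fun D : E n →L[ℝ] E (n + 1) => D v) hA
  have hBv : ∀ v : E n, B v = (mfderiv (𝓡 n) (𝓡 (n + 1)) ξ p v : E (n + 1)) := fun v =>
    congrArg (fun D : E n →L[ℝ] E (n + 1) => D v) hB
  have hB0 : ∀ v, B v 0 = 0 := fun v => by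
    have h1 := mfderiv_clm_comp_apply timeCoord hξd v
    have h2 := mfderiv_apply_eq_zero_of_const (G := fun q => timeCoord (ξ q)) h.time_eq_one p v
    exact (congrArg timeCoord (hBv v)).trans (h1.symm.trans h2)
  have hBξ : ∀ v, lorentz (ξ p) (B v) = 0 := fun v => by
    rw [← lorentzL_apply, hBv]
    exact bilin_mfderiv_eq_zero_of_const lorentzL
      (fun x y => by simp only [lorentzL_apply]; exact lorentz_comm x y)
      (c := 0) (fun q => by rw [lorentzL_apply]; exact h.null q) hξd v
  have hsymm : ∀ v w, lorentz (B v) (A w) = lorentz (B w) (A v) := fun v w => by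
    rw [← lorentzL_apply, ← lorentzL_apply, hBv, hBv, hAv, hAv]
    exact bilin_mfderiv_symm_of_orthogonal hr lorentzL h.smooth_front h.smooth_normal
      (fun q u => (lorentzL_apply _ _).trans (h.orthogonal q u)) p v w
  have hinj : ∀ v, A v = 0 → B v = 0 → v = 0 := fun v h1 h2 => by
    refine h.injective p (((h.mfderiv_prod hr0 p v).trans ?_).trans (map_zero _).symm)
    rw [← hA, ← hB]
    exact Prod.ext h1 h2
  have horth : ∀ v, lorentz (ξ p) (A v) = 0 := fun v => by
    rw [hA]; exact h.orthogonal p v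
  obtain ⟨v, h1, h2⟩ := exists_null_direction (V := E n) (A := A.toLinearMap) (B := B.toLinearMap)
    (by simp) (h.time_eq_one p) (h.null p) hB0 horth hBξ hsymm hinj
  rw [← hA, ← hB]
  exact ⟨v, h1, h2⟩

/-- Along an integral curve of the null field, the front runs through a light-like line with
constant direction. -/
theorem apply_integralCurve (h : IsNormalizedNullPair n r F ξ) (hr : r ≠ 0)
    {X : (p : M) → TangentSpace (𝓡 n) p}
    (hXF : ∀ p, (mfderiv (𝓡 n) (𝓡 (n + 1)) F p (X p) : E (n + 1)) = ξ p)
    (hXξ : ∀ p, (mfderiv (𝓡 n) (𝓡 (n + 1)) ξ p (X p) : E (n + 1)) = 0)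
    {γ : ℝ → M} (hγ : IsMIntegralCurve (I := 𝓡 n) γ X) (t : ℝ) :
    F (γ t) = F (γ 0) + t • ξ (γ 0) ∧ ξ (γ t) = ξ (γ 0) := by
  have hder : ∀ (f : M → E (n + 1)) (_ : ContMDiff (𝓡 n) (𝓡 (n + 1)) r f) (s : ℝ),
      HasDerivAt (f ∘ γ) (mfderiv (𝓡 n) (𝓡 (n + 1)) f (γ s) (X (γ s)) : E (n + 1)) s :=
    fun f hf s => (hγ s).hasDerivAt_comp (hf.mdifferentiable hr (γ s))
  have hξc : ∀ s, ξ (γ s) = ξ (γ 0) := fun s =>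
    is_const_of_deriv_eq_zero (fun u => (hder ξ h.smooth_normal u).differentiableAt)
      (fun u => by rw [(hder ξ h.smooth_normal u).deriv]; exact hXξ _) s 0
  have hFder : ∀ s, HasDerivAt (fun s => F (γ s) - s • ξ (γ 0)) 0 s := fun s => by
    have h1 := (hder F h.smooth_front s).sub ((hasDerivAt_id s).smul_const (ξ (γ 0)))
    rw [hXF, one_smul] at h1
    exact h1.congr_deriv (by rw [hξc, sub_self])
  have hFc := is_const_of_deriv_eq_zero (fun u => (hFder u).differentiableAt)
    (fun u => (hFder u).deriv) t 0
  refine ⟨?_, hξc t⟩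
  rw [zero_smul, sub_zero] at hFc
  rw [← hFc, sub_add_cancel]

end IsNormalizedNullPair

/-- The flow of the tautological null vector field on pairs of a point and a direction. -/
def geodesicFlow {V : Type*} [NormedAddCommGroup V] [NormedSpace ℝ V] (x : ℝ × (V × V)) : V × V :=
  (x.2.1 + x.1 • x.2.2, x.2.2)

theorem geodesicFlow_zero {V : Type*} [NormedAddCommGroup V] [NormedSpace ℝ V] (v : V × V) :
    geodesicFlow (0, v) = v := by
  simp [geodesicFlow]

theorem geodesicFlow_add {V : Type*} [NormedAddCommGroup V] [NormedSpace ℝ V] (s t : ℝ)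
    (v : V × V) : geodesicFlow (s + t, v) = geodesicFlow (s, geodesicFlow (t, v)) := by
  simp only [geodesicFlow, add_smul]
  rw [add_assoc, add_comm (s • _)]

theorem contDiff_geodesicFlow {V : Type*} [NormedAddCommGroup V] [NormedSpace ℝ V] :
    ContDiff ℝ r (geodesicFlow (V := V)) := by
  unfold geodesicFlow
  fun_prop

/-- An `L`-complete null front carries a complete null flow. -/
theorem IsNullFront.exists_flow [IsManifold (𝓡 n) r M] [IsManifold (𝓡 n) 1 M] (hr2 : 2 ≤ r)
    (hr1 : r + 1 ≤ r) {F : M → E (n + 1)} {α : M → PDual (n + 1)} (hF : IsNullFront n r F α)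
    (hL : IsLComplete n r F α) :
    ∃ (ξ : M → E (n + 1)) (φ : ℝ → M → M) (X : (p : M) → TangentSpace (𝓡 n) p),
      IsNormalizedNullPair n r F ξ ∧ IsFlowLift (fun q => (F q, ξ q)) geodesicFlow φ ∧
      ∀ p, (mfderiv (𝓡 n) (𝓡 (n + 1)) F p (X p) : E (n + 1)) = ξ p := by
  have hr0 : r ≠ 0 := by rintro rfl; simp at hr2
  obtain ⟨ξ, hξ, hlift, h1, hnull⟩ := hF.exists_normalField
  have hpair : IsNormalizedNullPair n r F ξ :=
    { smooth_front := hF.1.1.1.1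
      smooth_normal := hξ
      time_eq_one := h1
      null := hnull
      orthogonal := fun p v => (lorentzL_apply _ _).symm.trans <|
        hlift.apply_mfderiv_eq_zero hF.1.1.1 p v
      injective := hF.1.1.injective_mfderiv_prod hr0 hξ hlift h1 }
  -- The vectors are chosen point by point. Smoothness follows because the immersion `(F, ξ)` sends
  -- `X` to the `C^r` field `(ξ, 0)`.
  choose X hXF hXξ using hpair.exists_tangent_null hr2
  have hXs : IsSmoothVectorField n r X :=
    contMDiff_section_of_mfderiv_immersion hr1 hpair.smooth_prod hpair.injective
      (w := fun p => (ξ p, 0)) (hξ.prodMk_space contMDiff_const) X fun p => by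
        rw [hpair.mfderiv_prod hr0]; exact Prod.ext (hXF p) (hXξ p)
  have hcurve : ∀ p, ∃ γ : ℝ → M, IsMIntegralCurve (I := 𝓡 n) γ X ∧ γ 0 = p := by
    intro p
    obtain ⟨γ, hγ, ⟨s, hs⟩, -⟩ :=
      hL X ⟨hXs, ξ, isENormalized_of_time_eq_one hξ hlift h1 hnull, hXF⟩ p
    exact ⟨γ ∘ (· + s), hγ.comp_add s, by simpa using hs⟩
  choose γ hγ hγ0 using hcurve
  -- Integral curves are picked independently for each starting point; only their continuity and
  -- their image under `(F, ξ)` are recorded, and uniqueness of lifts makes them cohere into a flow.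
  refine ⟨ξ, fun t p => γ p t, X, hpair, ⟨hγ0, fun p => (hγ p).continuous, fun t p => ?_⟩, hXF⟩
  have h2 := hpair.apply_integralCurve hr0 hXF hXξ (hγ p) t
  rw [hγ0] at h2
  exact Prod.ext h2.1 h2.2

end NullFlow

/-! ### Wave fronts from a unit normal field -/

section EuclideanFronts

variable {k : ℕ}

/-- The Euclidean inner product as a real bilinear map. -/
def innerL : E k →L[ℝ] StrongDual ℝ (E k) :=
  (isBoundedBilinearMap_inner (𝕜 := ℝ) (E := E k)).toContinuousLinearMap

@[simp] theorem innerL_apply (x y : E k) : innerL x y = inner ℝ x y := rfl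

theorem innerSL_ne_zero {x : E k} (hx : ‖x‖ = 1) : (innerSL ℝ x : StrongDual ℝ (E k)) ≠ 0 := by
  intro h
  have h1 := congrArg (fun φ : StrongDual ℝ (E k) => φ x) h
  simp [hx] at h1

/-- The kernel of the derivative of `φ ↦ φ / φ(e)` consists of the radial directions. -/
theorem exists_hasFDerivAt_normalize {V : Type*} [NormedAddCommGroup V] [NormedSpace ℝ V] {e : V}
    {φ : StrongDual ℝ V} (he : φ e ≠ 0) :
    ∃ D : StrongDual ℝ V →L[ℝ] StrongDual ℝ V,
      HasFDerivAt (fun ψ : StrongDual ℝ V => (ψ e)⁻¹ • ψ) D φ ∧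
        ∀ ψ, D ψ = 0 → ∃ s : ℝ, ψ = s • φ := by
  have h1 : HasFDerivAt (fun ψ : StrongDual ℝ V => ψ e) (ContinuousLinearMap.apply ℝ ℝ e) φ :=
    (ContinuousLinearMap.apply ℝ ℝ e).hasFDerivAt
  have h2 := ((hasDerivAt_inv he).comp_hasFDerivAt φ h1).smul (hasFDerivAt_id φ)
  refine ⟨_, h2, fun ψ hψ => ?_⟩
  -- Here `D ψ = ψ / φ(e) - (ψ(e) / φ(e)^2) φ`, so its vanishing makes `ψ` a multiple of `φ`.
  have h3 : (φ e)⁻¹ • ψ = ((φ e ^ 2)⁻¹ * ψ e) • φ := by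
    ext x
    have h4 := congrArg (fun χ : StrongDual ℝ V => χ x) hψ
    simp at h4 ⊢
    linarith
  refine ⟨φ e * ((φ e ^ 2)⁻¹ * ψ e), ?_⟩
  rw [← smul_smul, ← h3, smul_smul, mul_inv_cancel₀ he, one_smul]

variable {n : ℕ} {S : Type*} [TopologicalSpace S] [ChartedSpace (E n) S] {r : ℕ∞ω}

/-- A map `f` with a unit normal field `ν` such that `(f, ν)` is an immersion is a wave front. -/
theorem isCoorientableFront_of_unitNormal (hr : r ≠ 0) {f ν : S → E k}
    (hf : ContMDiff (𝓡 n) (𝓡 k) r f) (hν : ContMDiff (𝓡 n) (𝓡 k) r ν) (hnorm : ∀ p, ‖ν p‖ = 1)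
    (horth : ∀ p v, inner ℝ (ν p) (mfderiv (𝓡 n) (𝓡 k) f p v : E k) = 0)
    (himm : ∀ p v, (mfderiv (𝓡 n) (𝓡 k) f p v : E k) = 0 →
      (mfderiv (𝓡 n) (𝓡 k) ν p v : E k) = 0 → v = 0) :
    ∃ β : S → PDual k, IsCoorientableFront n r f β ∧ IsUnitNormal n r β ν := by
  let β : S → PDual k := fun p =>
    Projectivization.mk ℝ (innerSL ℝ (ν p)) (innerSL_ne_zero (hnorm p))
  have hlift : IsLift n r β (fun p => innerSL ℝ (ν p)) :=
    ⟨innerL.contMDiff.comp hν, fun p => ⟨innerSL_ne_zero (hnorm p), rfl⟩⟩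
  refine ⟨β, ⟨⟨⟨hf, hlift.isProjSmooth, fun p v => ?_⟩, fun p e he => ?_⟩, _, hlift⟩,
    hν, hnorm, hlift⟩
  · obtain ⟨a, -, hp⟩ := hlift.exists_rep_eq p
    rw [hp]
    change a * inner ℝ (ν p) _ = 0
    rw [horth, mul_zero]
  · have he' : innerL (ν p) e ≠ 0 := (hlift.rep_apply_ne_zero_iff e p).1 he
    have hχ : (fun q => (f q, affineChart e (β q))) =
        fun q => (f q, (innerL (ν q) e)⁻¹ • innerL (ν q)) := by
      funext q; rw [hlift.affineChart_eq]; rfl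
    rw [hχ]
    have hfd := hf.mdifferentiable hr p
    have hνd := hν.mdifferentiable hr p
    have hζd : MDifferentiableAt (𝓡 n) 𝓘(ℝ, StrongDual ℝ (E k)) (fun q => innerL (ν q)) p :=
      (innerL.contMDiff.comp hν).mdifferentiable hr p
    obtain ⟨D, hD, hDker⟩ := exists_hasFDerivAt_normalize he'
    have hκd : MDifferentiableAt (𝓡 n) 𝓘(ℝ, StrongDual ℝ (E k))
        (fun q => (innerL (ν q) e)⁻¹ • innerL (ν q)) p :=
      MDifferentiableAt.comp (g := fun ψ : StrongDual ℝ (E k) => (ψ e)⁻¹ • ψ) p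
        hD.differentiableAt.mdifferentiableAt hζd
    have hQ := hfd.prodMk_space hκd
    refine (injective_iff_map_eq_zero (mfderiv (𝓡 n) 𝓘(ℝ, E k × StrongDual ℝ (E k))
      (fun q => (f q, (innerL (ν q) e)⁻¹ • innerL (ν q))) p)).2 fun v hv => ?_
    have h1 := (mfderiv_clm_comp_apply (ContinuousLinearMap.fst ℝ _ _) hQ v).trans
      (congrArg Prod.fst hv)
    have h2 := (mfderiv_clm_comp_apply (ContinuousLinearMap.snd ℝ _ _) hQ v).trans
      (congrArg Prod.snd hv)
    have h3 := (mfderiv_comp_apply_of_hasFDerivAt (G := fun q => innerL (ν q))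
      hD hζd v).symm.trans h2
    -- Vanishing in the affine chart leaves `dν(v) = s ν`. Since `|ν| = 1` gives `dν(v) ⊥ ν`, in
    -- fact `dν(v) = 0`.
    obtain ⟨s, hs⟩ := hDker _ h3
    have h4 := (mfderiv_clm_comp_apply innerL hνd v).symm.trans hs
    have h5 := bilin_mfderiv_eq_zero_of_const innerL (fun x y => real_inner_comm y x) (c := 1)
      (fun q => by rw [innerL_apply, real_inner_self_eq_norm_sq, hnorm, one_pow]) hνd v
    refine himm p v h1 ?_
    obtain ⟨w, hw⟩ : ∃ w : E k, w = mfderiv (𝓡 n) (𝓡 k) ν p v := ⟨_, rfl⟩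
    rw [← hw] at h4 h5 ⊢
    have h6 : inner ℝ w w = s * inner ℝ (ν p) w :=
      congrArg (fun φ : StrongDual ℝ (E k) => φ w) h4
    have h7 : inner ℝ (ν p) w = 0 := h5
    rw [h7, mul_zero, inner_self_eq_zero] at h6
    exact h6

end EuclideanFronts

/-! ### The zero time slice and the normal form -/

section MainTheorem

/-- The differential of a map with a differentiable left inverse is injective. -/
theorem injective_mfderiv_of_leftInverse {H K M S : Type*} [NormedAddCommGroup H]
    [NormedSpace ℝ H] [NormedAddCommGroup K] [NormedSpace ℝ K] [TopologicalSpace M]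
    [ChartedSpace H M] [TopologicalSpace S] [ChartedSpace K S] {i : S → M} {π : M → S} {p : S}
    (hπi : Function.LeftInverse π i) (hi : MDifferentiableAt 𝓘(ℝ, K) 𝓘(ℝ, H) i p)
    (hπ : MDifferentiableAt 𝓘(ℝ, H) 𝓘(ℝ, K) π (i p)) :
    Function.Injective (mfderiv 𝓘(ℝ, K) 𝓘(ℝ, H) i p) := by
  have h1 := (hπ.hasMFDerivAt.comp p hi.hasMFDerivAt)
  rw [show π ∘ i = id from funext hπi] at h1
  have h2 := hasMFDerivAt_unique h1 (hasMFDerivAt_id p)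
  intro v w hvw
  have h3 := fun u => congrArg (fun D : K →L[ℝ] K => D u) h2
  exact (h3 v).symm.trans ((congrArg (mfderiv 𝓘(ℝ, H) 𝓘(ℝ, K) π (i p)) hvw).trans (h3 w))

/-- The regularity enters only through two inequalities: `2 ≤ r` gives symmetry of second
derivatives, and `r + 1 ≤ r` lets tangent maps stay `C^r`. -/
theorem exists_normalForm_of_isLComplete {m : ℕ} {r : ℕ∞ω} (hr2 : 2 ≤ r) (hr1 : r + 1 ≤ r)
    {M : Type u} [TopologicalSpace M] [T2Space M] [SecondCountableTopology M]
    [ChartedSpace (E (m + 1)) M] [IsManifold (𝓡 (m + 1)) r M] [IsManifold (𝓡 (m + 1)) 1 M]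
    (F : M → E (m + 1 + 1)) (α : M → PDual (m + 1 + 1)) (hF : IsNullFront (m + 1) r F α)
    (hL : IsLComplete (m + 1) r F α) :
    ∃ (S : Type u) (_ : TopologicalSpace S) (_ : T2Space S) (_ : SecondCountableTopology S)
      (_ : ChartedSpace (E m) S) (_ : IsManifold (𝓡 m) r S)
      (Φ : (ℝ × S) ≃ₘ^r⟮𝓘(ℝ, ℝ).prod (𝓡 m), 𝓡 (m + 1)⟯ M)
      (f : S → E (m + 1)) (β : S → PDual (m + 1)) (ν : S → E (m + 1)),
      IsCoorientableFront m r f β ∧ IsUnitNormal m r β ν ∧ F ∘ Φ = normalForm f ν := by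
  have hr0 : r ≠ 0 := by rintro rfl; simp at hr2
  obtain ⟨ξ, φ, X, hpair, hφ, hX⟩ := hF.exists_flow hr2 hr1 hL
  have hφs := hφ.contMDiff hpair.smooth_prod hr0 hpair.injective contDiff_geodesicFlow
    geodesicFlow_zero geodesicFlow_add
  have hφadd := hφ.add hpair.smooth_prod hr0 hpair.injective geodesicFlow_add
  have hFφ : ∀ t p, F (φ t p) = F p + t • ξ p := fun t p => congrArg Prod.fst (hφ.lift t p)
  let τ : M → ℝ := fun q => timeCoord (F q)
  have hτφ : ∀ t p, τ (φ t p) = τ p + t := fun t p => by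
    change timeCoord (F (φ t p)) = timeCoord (F p) + t
    rw [hFφ, map_add, map_smul, timeCoord_apply (ξ p), hpair.time_eq_one, smul_eq_mul, mul_one]
  have hFd : MDifferentiable (𝓡 (m + 1)) (𝓡 (m + 1 + 1)) F :=
    hpair.smooth_front.mdifferentiable hr0
  have hξd : MDifferentiable (𝓡 (m + 1)) (𝓡 (m + 1 + 1)) ξ :=
    hpair.smooth_normal.mdifferentiable hr0
  have hτ : HasRegularZeroSet (E (m + 1)) (E m) r τ :=
    { contMDiff := timeCoord.contMDiff.comp hpair.smooth_front
      ne_zero := hr0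
      surjective := fun p _ (c : ℝ) => by
        -- The null field satisfies `dτ(X) = 1`.
        refine ⟨c • X p, (mfderiv_clm_comp_apply timeCoord (hFd p) (c • X p)).trans ?_⟩
        rw [map_smul]
        refine (map_smul timeCoord c (mfderiv (𝓡 (m + 1)) (𝓡 (m + 1 + 1)) F p (X p) :
          E (m + 1 + 1))).trans ?_
        have h1 : timeCoord (ξ p) = 1 := hpair.time_eq_one p
        exact (congrArg (fun x : E (m + 1 + 1) => c • timeCoord x) (hX p)).trans
          (by rw [h1, smul_eq_mul, mul_one])
      finrank_eq := by simp }
  let ι : hτ.ZeroSet → M := hτ.incl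
  have hι : ContMDiff (𝓡 m) (𝓡 (m + 1)) r ι := hτ.contMDiff_incl
  have hιd : MDifferentiable (𝓡 m) (𝓡 (m + 1)) ι := hι.mdifferentiable hr0
  have hτι : ∀ p, τ (ι p) = 0 := hτ.apply_incl
  -- Flow back by the time `τ q` to reach the zero slice.
  let π : M → hτ.ZeroSet := fun q => ⟨φ (-τ q) q, by rw [hτφ, add_neg_cancel]⟩
  have hιπ : ∀ q, ι (π q) = φ (-τ q) q := fun q => rfl
  have hπ : ContMDiff (𝓡 (m + 1)) (𝓡 m) r π :=
    hτ.contMDiff_of_incl_comp (hφs.comp (hτ.contMDiff.neg.prodMk contMDiff_id))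
  have hπφ : ∀ t p, π (φ t (ι p)) = p := fun t p => Subtype.ext <| by
    change φ (-τ (φ t (ι p))) (φ t (ι p)) = ι p
    rw [hτφ, hτι, zero_add, ← hφadd, neg_add_cancel, hφ.zero]
  have hπι : Function.LeftInverse π ι := fun p => by
    have := hπφ 0 p
    rwa [hφ.zero] at this
  let Φ : (ℝ × hτ.ZeroSet) ≃ₘ^r⟮𝓘(ℝ, ℝ).prod (𝓡 m), 𝓡 (m + 1)⟯ M :=
    { toFun := fun x => φ x.1 (ι x.2)
      invFun := fun q => (τ q, π q)
      left_inv := fun x => Prod.ext ((hτφ _ _).trans (by rw [hτι, zero_add])) (hπφ _ _)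
      right_inv := fun q => by
        simp only [hιπ]
        rw [← hφadd, add_neg_cancel, hφ.zero]
      contMDiff_toFun := hφs.comp (contMDiff_fst.prodMk (hι.comp contMDiff_snd))
      contMDiff_invFun := hτ.contMDiff.prodMk hπ }
  let f : hτ.ZeroSet → E (m + 1) := fun p => spatial (F (ι p))
  let ν : hτ.ZeroSet → E (m + 1) := fun p => spatial (ξ (ι p))
  have hνν : ∀ p, ‖ν p‖ = 1 := fun p => by
    have h1 := hpair.null (ι p)
    rw [lorentz_eq, hpair.time_eq_one, real_inner_self_eq_norm_sq] at h1
    have h2 : ‖ν p‖ ^ 2 = 1 := by linarith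
    exact (pow_eq_one_iff_of_nonneg (norm_nonneg _) two_ne_zero).1 h2
  have hdι : ∀ (G : M → E (m + 1 + 1)) (_ : MDifferentiable (𝓡 (m + 1)) (𝓡 (m + 1 + 1)) G)
      (p : hτ.ZeroSet) (v : TangentSpace (𝓡 m) p),
      (mfderiv (𝓡 m) (𝓡 (m + 1)) (fun q => spatial (G (ι q))) p v : E (m + 1)) =
        spatial (mfderiv (𝓡 (m + 1)) (𝓡 (m + 1 + 1)) G (ι p)
          (mfderiv (𝓡 m) (𝓡 (m + 1)) ι p v)) := fun G hG p v => by
    have h1 := mfderiv_clm_comp_apply (H := E m) spatial ((hG (ι p)).comp p (hιd p)) v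
    rw [mfderiv_comp p (hG (ι p)) (hιd p)] at h1
    exact h1
  -- Applied with `G = F`, `c = 0` and `G = ξ`, `c = 1`: along the slice both derivatives are purely
  -- spatial.
  have hdτ : ∀ (G : M → E (m + 1 + 1)) (_ : MDifferentiable (𝓡 (m + 1)) (𝓡 (m + 1 + 1)) G)
      (c : ℝ) (_ : ∀ p, G (ι p) 0 = c) (p : hτ.ZeroSet) (v : TangentSpace (𝓡 m) p),
      timeCoord (mfderiv (𝓡 (m + 1)) (𝓡 (m + 1 + 1)) G (ι p)
        (mfderiv (𝓡 m) (𝓡 (m + 1)) ι p v)) = 0 := fun G hG c hc p v => by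
    have h1 := mfderiv_clm_comp_apply (H := E m) timeCoord ((hG (ι p)).comp p (hιd p)) v
    rw [mfderiv_comp p (hG (ι p)) (hιd p)] at h1
    exact h1.symm.trans (mfderiv_apply_eq_zero_of_const (G := fun q => timeCoord (G (ι q))) hc p v)
  obtain ⟨β, hβ, hν⟩ := isCoorientableFront_of_unitNormal (S := hτ.ZeroSet) (n := m) hr0
    (f := f) (ν := ν)
    (spatial.contMDiff.comp (hpair.smooth_front.comp hι))
    (spatial.contMDiff.comp (hpair.smooth_normal.comp hι)) hνν
    (fun p v => by
      obtain ⟨w, hw⟩ : ∃ w : E (m + 1 + 1), w = mfderiv (𝓡 (m + 1)) (𝓡 (m + 1 + 1)) F (ι p)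
        (mfderiv (𝓡 m) (𝓡 (m + 1)) ι p v) := ⟨_, rfl⟩
      have h1 : lorentz (ξ (ι p)) w = 0 := by rw [hw]; exact hpair.orthogonal _ _
      have h2 : w 0 = 0 := (congrArg timeCoord hw).trans (hdτ F hFd 0 hτι p v)
      rw [lorentz_eq, h2, mul_zero, neg_zero, zero_add] at h1
      exact (congrArg (inner ℝ (ν p)) ((hdι F hFd p v).trans (congrArg spatial hw.symm))).trans h1)
    -- With the time parts zero, `df(v) = dν(v) = 0` gives `d(F, ξ)(dι(v)) = 0`. Both `(F, ξ)` and
    -- `ι` are immersions, the latter because `π` is a left inverse of it.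
    (fun p v h1 h2 => by
      have h3 := ext_time_spatial (w := 0) (hdτ F hFd 0 hτι p v)
        ((hdι F hFd p v).symm.trans (h1.trans (map_zero _).symm))
      have h4 := ext_time_spatial (w := 0) (hdτ ξ hξd 1 (fun q => hpair.time_eq_one _) p v)
        ((hdι ξ hξd p v).symm.trans (h2.trans (map_zero _).symm))
      refine injective_mfderiv_of_leftInverse hπι (hιd p) (hπ.mdifferentiable hr0 (ι p)) ?_
      rw [map_zero]
      refine hpair.injective (ι p) ((hpair.mfderiv_prod hr0 _ _).trans ?_)
      exact (Prod.ext h3 h4).trans (map_zero _).symm)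
  refine ⟨hτ.ZeroSet, inferInstance, inferInstance, inferInstance, inferInstance, inferInstance,
    Φ, f, β, ν, hβ, hν, ?_⟩
  funext x
  change F (φ x.1 (ι x.2)) = _
  rw [hFφ]
  refine ext_time_spatial ?_ ?_
  · have h1 : F (ι x.2) 0 = 0 := hτι x.2
    simp [normalForm, h1, hpair.time_eq_one]
  · simp [normalForm, f, ν]

end MainTheorem

end

theorem theorem2p3 {n : ℕ} (hn : 1 ≤ n) {r : ℕ∞ω} (hr : r = ∞ ∨ r = ω)
    {M : Type u} [TopologicalSpace M] [T2Space M] [SecondCountableTopology M]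
    [ChartedSpace (E n) M] [IsManifold (𝓡 n) r M]
    (F : M → E (n + 1)) (α : M → PDual (n + 1)) (hF : IsNullFront n r F α)
    (hL : haveI := isManifold_one n hr M; IsLComplete n r F α) :
    ∃ (S : Type u) (_ : TopologicalSpace S) (_ : T2Space S) (_ : SecondCountableTopology S)
      (_ : ChartedSpace (E (n - 1)) S) (_ : IsManifold (𝓡 (n - 1)) r S)
      (Φ : (ℝ × S) ≃ₘ^r⟮𝓘(ℝ, ℝ).prod (𝓡 (n - 1)), 𝓡 n⟯ M)
      (f : S → E n) (β : S → PDual n) (ν : S → E n),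
      IsCoorientableFront (n - 1) r f β ∧ IsUnitNormal (n - 1) r β ν ∧
        F ∘ Φ = normalForm f ν := by
  obtain ⟨m, rfl⟩ : ∃ m, n = m + 1 := ⟨n - 1, by omega⟩
  have := isManifold_one (m + 1) hr M
  have hr2 : 2 ≤ r := by
    rcases hr with rfl | rfl
    · exact WithTop.coe_le_coe.2 (le_top : (2 : ℕ∞) ≤ ⊤)
    · exact le_top
  -- Both `∞` and `ω` absorb the added `1`.
  have hr1 : r + 1 ≤ r := by
    rcases hr with rfl | rfl <;> exact le_rfl
  exact exists_normalForm_of_isLComplete hr2 hr1 F α hF hL
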